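/- For integers $1\le r\le k$, a symmetric $k\times k$ real matrix $A=(a_{ij})$ and $\mathbf{x}\in\mathbb{R}^k$, put $$L_r(A,\mathbf{x})=\sum_{X\subseteq\{1,\dots,k\},\ |X|=r}\ \prod_{i,j\in X,\ i<j}a_{ij}\prod_{i\in X}x_i .$$ For $c\in(0,1/2)$ let $\mathcal{S}_k(c)$ be the set of pairs $(A,\mathbf{x})$ in which $A$ is a symmetric $k\times k$ matrix with zero diagonal and all entries in $[0,1]$, $\mathbf{x}\in\mathbb{R}^k$ has nonnegative entries, $L_1(A,\mathbf{x})=1$ and $L_2(A,\mathbf{x})=c$. Let $c\in(0,1/2)$, $s=\lceil 1/(1-2c)\rceil$, $r\in\{3,4\}$, and let $n$ be an integer with $r\le s\le n$. Let $A_s$ be the $s\times s$ matrix with zero diagonal and all off-diagonal entries equal to $1$, and let $\mathbf{x}_c=(x,\dots,x,y)\in\mathbb{R}^s$, where $$x=\frac1s+\frac1s\sqrt{1-\frac{2s}{s-1}c},\qquad y=\frac1s-\frac{s-1}{s}\sqrt{1-\frac{2s}{s-1}c}.$$ Then $(A_s,\mathbf{x}_c)\in\mathcal{S}_s(c)$,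 and $$\min\left\{L_r(A,\mathbf{x}) : r\le k\le n,\ (A,\mathbf{x})\in\mathcal{S}_k(c)\right\}=L_r(A_s,\mathbf{x}_c).$$ In particular the minimum exists, does not depend on $n$, and is attained at $(A_s,\mathbf{x}_c)$. -/

import Mathlib

namespace CliqueForms

/-- The form `L_r(A, x) = ∑_{X} ∏_{i < j in X} a_{ij} ∏_{i in X} x_i`, where `X` runs over the
`r`-element subsets of the index set. -/
def L {n : ℕ} (r : ℕ) (A : Matrix (Fin n) (Fin n) ℝ) (x : Fin n → ℝ) : ℝ :=
  ∑ X ∈ Finset.powersetCard r (Finset.univ : Finset (Fin n)),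
    (∏ p ∈ (X ×ˢ X).filter (fun p => p.1 < p.2), A p.1 p.2) * ∏ i ∈ X, x i

/-- The symmetric `n × n` matrices with zero diagonal and entries in `[0, 1]`. -/
def matrices (n : ℕ) : Set (Matrix (Fin n) (Fin n) ℝ) :=
  {A | (∀ i, A i i = 0) ∧ ∀ i j, 0 ≤ A i j ∧ A i j = A j i ∧ A j i ≤ 1}

/-- The feasible set `S_n(c)`. -/
def feasible (n : ℕ) (c : ℝ) : Set (Matrix (Fin n) (Fin n) ℝ × (Fin n → ℝ)) :=
  {p | p.1 ∈ matrices n ∧ (∀ i, 0 ≤ p.2 i) ∧ L 1 p.1 p.2 = 1 ∧ L 2 p.1 p.2 = c}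

/-- The values over which the minimum `φ_r(n, c)` is taken: `L_r(A, x)` for
`(A, x) ∈ S_k(c)` with `r ≤ k ≤ n`. -/
def values (r n : ℕ) (c : ℝ) : Set ℝ :=
  {v | ∃ k : ℕ, r ≤ k ∧ k ≤ n ∧ ∃ p ∈ feasible k c, L r p.1 p.2 = v}

/-- `ξ(c) = ⌈1 / (1 - 2c)⌉`. -/
noncomputable def xi (c : ℝ) : ℕ := ⌈1 / (1 - 2 * c)⌉₊

/-- The matrix `A_s` with zero diagonal and all off-diagonal entries equal to `1`. -/
def completeMatrix (s : ℕ) : Matrix (Fin s) (Fin s) ℝ :=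
  Matrix.of fun i j => if i = j then 0 else 1

/-- The weight `x = 1/s + (1/s) √(1 - 2sc/(s-1))`. -/
noncomputable def weightX (s : ℕ) (c : ℝ) : ℝ :=
  1 / (s : ℝ) + 1 / (s : ℝ) * Real.sqrt (1 - 2 * (s : ℝ) / ((s : ℝ) - 1) * c)

/-- The weight `y = 1/s - ((s-1)/s) √(1 - 2sc/(s-1))`. -/
noncomputable def weightY (s : ℕ) (c : ℝ) : ℝ :=
  1 / (s : ℝ) - ((s : ℝ) - 1) / (s : ℝ) * Real.sqrt (1 - 2 * (s : ℝ) / ((s : ℝ) - 1) * c)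

/-- The `s`-vector `(x, …, x, y)`. -/
noncomputable def extremalVector (s : ℕ) (c : ℝ) : Fin s → ℝ :=
  fun i => if (i : ℕ) + 1 < s then weightX s c else weightY s c

/-- `φ_r(c) = L_r(A_s, x_c)` with `s = ξ(c)`. -/
noncomputable def phi (r : ℕ) (c : ℝ) : ℝ :=
  L r (completeMatrix (xi c)) (extremalVector (xi c) c)

end CliqueForms

/-!
Lower bounds for `L_3` and `L_4` on pairs `(A, x)` with `L_1 = 1` and `L_2 = c`.

Both bounds come from a minimiser argument. Write `s = ξ(c)`, so that `c` lies in the interval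
`[(s-2)/(2(s-1)), (s-1)/(2s)]` between two consecutive Turán densities, and let `φ(c)` be the value
of `L_r` at the extremal pair. If `L_r ≥ φ(L_2)` fails somewhere with `L_2` in this interval, then by
compactness `L_r - φ(L_2)` has a negative minimum; it is not attained at the ends of the interval,
where Goodman's bound (`goodman`) and its analogue for four-cliques settle the matter. So it
is attained at a point where the first-order conditions hold with multiplier `μ = φ'(c)`
(`exists_firstOrder`). Writing `t` for the repeated weight of the extremal vector,
`μ = (s-2) t` for `r = 3` and `μ = binom(s-2,2) t²` for `r = 4`.

The first-order conditions say that `L_{r-1}` of the link of a vertex is an affine function of its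
degree (`FirstOrder.link_eq`, `FirstOrder.link_le`), and for `r = 3`, through the perturbation that
lowers each `a_{ij}` in proportion to the weight of the common non-neighbours of `i` and `j`, they
bound the sum of squared codegrees. Together with an inclusion-exclusion bound for `L_4`
(`four_L_four_le`) the sum of squared degrees cancels, and an upper bound for `L_4` in terms of `L_2`
and `L_3` remains (`FirstOrder.four_mul_L_four_le`).

Triangles are treated by induction on `s` (`triangleBound`). Inside the link of a vertex, whose
degree and number of edges are restricted by the first-order conditions, Goodman's bound and
the case of `s - 1` parts show that the number of triangles lies above a plane which is tangent to
the extremal surface along all vectors `(t, …, t, y)` (`plane_le`). Averaging over the vertices gives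
a lower bound for `L_4` that contradicts the upper one.

For four-cliques no induction is needed. In each link the number of triangles is determined by the
degree, and the triangle theorem then bounds the number of edges of the link (`lt_line`). Averaging
over the vertices shows that `L_3` is smaller than the triangle theorem allows.

At the extremal pair the forms are elementary symmetric functions, computed from power sums.
-/

namespace CliqueForms

open Finset Filter Topology

variable {n : ℕ} {A : Matrix (Fin n) (Fin n) ℝ} {x : Fin n → ℝ}

/-! ### The forms and the links of vertices -/

/-- The weights of the neighbourhood of `i`: vertex `j` carries `a_{ij} x_j`.  As `a_{ii} = 0`,
the forms evaluated at `link A i x` see only cliques that extend by `i`. -/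
def link (A : Matrix (Fin n) (Fin n) ℝ) (i : Fin n) (x : Fin n → ℝ) : Fin n → ℝ :=
  fun j => A i j * x j

/-- The product of the entries `a_{ij}` over the pairs `i < j` in `X`. -/
def edgeProd (A : Matrix (Fin n) (Fin n) ℝ) (X : Finset (Fin n)) : ℝ :=
  ∏ p ∈ (X ×ˢ X).filter (fun p => p.1 < p.2), A p.1 p.2

theorem L_eq_sum_edgeProd (r : ℕ) (A : Matrix (Fin n) (Fin n) ℝ) (x : Fin n → ℝ) :
    L r A x = ∑ X ∈ powersetCard r univ, edgeProd A X * ∏ i ∈ X, x i := rfl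

theorem edgeProd_nonneg (hA : A ∈ matrices n) (X : Finset (Fin n)) : 0 ≤ edgeProd A X :=
  prod_nonneg fun p _ => (hA.2 p.1 p.2).1

theorem edgeProd_insert (hA : A ∈ matrices n) {j : Fin n} {X : Finset (Fin n)} (hj : j ∉ X) :
    edgeProd A (insert j X) = edgeProd A X * ∏ i ∈ X, A j i := by
  classical
  have hsym : ∀ i, A i j = A j i := fun i => (hA.2 i j).2.1
  have key : ((insert j X ×ˢ insert j X).filter (fun p : Fin n × Fin n => p.1 < p.2)) =
      ((X ×ˢ X).filter (fun p => p.1 < p.2)) ∪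
        X.image (fun i => if i < j then (i, j) else (j, i)) := by
    ext ⟨a, b⟩
    simp only [mem_filter, mem_product, mem_insert, mem_union, mem_image]
    constructor
    · rintro ⟨⟨rfl | ha, rfl | hb⟩, hab⟩
      · exact absurd hab (lt_irrefl _)
      · exact Or.inr ⟨b, hb, by rw [if_neg (not_lt.mpr hab.le)]⟩
      · exact Or.inr ⟨a, ha, by rw [if_pos hab]⟩
      · exact Or.inl ⟨⟨ha, hb⟩, hab⟩
    · rintro (⟨⟨ha, hb⟩, hab⟩ | ⟨i, hi, h⟩)
      · exact ⟨⟨Or.inr ha, Or.inr hb⟩, hab⟩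
      · have hij : i ≠ j := fun h => hj (h ▸ hi)
        split_ifs at h with hlt
        · obtain ⟨rfl, rfl⟩ := Prod.mk.inj h
          exact ⟨⟨Or.inr hi, Or.inl rfl⟩, hlt⟩
        · obtain ⟨rfl, rfl⟩ := Prod.mk.inj h
          exact ⟨⟨Or.inl rfl, Or.inr hi⟩, lt_of_le_of_ne (not_lt.mp hlt) hij.symm⟩
  have hdisj : Disjoint ((X ×ˢ X).filter (fun p : Fin n × Fin n => p.1 < p.2))
      (X.image (fun i => if i < j then (i, j) else (j, i))) := by
    rw [Finset.disjoint_left]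
    rintro ⟨a, b⟩ h1 h2
    simp only [mem_filter, mem_product, mem_image] at h1 h2
    obtain ⟨i, hi, h⟩ := h2
    split_ifs at h
    · exact hj ((Prod.mk.inj h).2 ▸ h1.1.2)
    · exact hj ((Prod.mk.inj h).1 ▸ h1.1.1)
  unfold edgeProd
  rw [key, prod_union hdisj, prod_image]
  · congr 1
    refine prod_congr rfl fun i _ => ?_
    split_ifs
    · exact hsym i
    · rfl
  · intro a ha b hb hab
    have h1 : a ≠ j := fun h => hj (h ▸ ha)
    have h2 : b ≠ j := fun h => hj (h ▸ hb)
    dsimp only at hab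
    split_ifs at hab
    · exact (Prod.mk.inj hab).1
    · exact absurd (Prod.mk.inj hab).1 h1
    · exact absurd (Prod.mk.inj hab).1.symm h2
    · exact (Prod.mk.inj hab).2

theorem edgeProd_congr {B : Matrix (Fin n) (Fin n) ℝ} {j : Fin n} {X : Finset (Fin n)}
    (hAB : ∀ a b, a ≠ j → b ≠ j → A a b = B a b) (hj : j ∉ X) :
    edgeProd A X = edgeProd B X := by
  refine prod_congr rfl fun p hp => ?_
  simp only [mem_filter, mem_product] at hp
  exact hAB _ _ (fun h => hj (h ▸ hp.1.1)) (fun h => hj (h ▸ hp.1.2))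

/-- If the weight of `j` vanishes, then only subsets avoiding `j` contribute. -/
theorem L_eq_sum_erase {j : Fin n} (hx : x j = 0) (r : ℕ) (A : Matrix (Fin n) (Fin n) ℝ) :
    L r A x = ∑ X ∈ powersetCard r (univ.erase j), edgeProd A X * ∏ i ∈ X, x i := by
  rw [L_eq_sum_edgeProd]
  symm
  refine sum_subset (powersetCard_mono (erase_subset _ _)) fun X hX hX' => ?_
  have hj : j ∈ X := by
    by_contra h
    exact hX' (mem_powersetCard.mpr ⟨subset_erase.mpr ⟨subset_univ _, h⟩,
      (mem_powersetCard.mp hX).2⟩)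
  rw [prod_eq_zero hj hx, mul_zero]

/-- The matrix entries at a vertex of weight zero are irrelevant. -/
theorem L_congr_of_apply_eq_zero {B : Matrix (Fin n) (Fin n) ℝ} {j : Fin n}
    (hAB : ∀ a b, a ≠ j → b ≠ j → A a b = B a b) (hx : x j = 0) (r : ℕ) :
    L r A x = L r B x := by
  rw [L_eq_sum_erase hx, L_eq_sum_erase hx]
  refine sum_congr rfl fun X hX => ?_
  rw [edgeProd_congr hAB]
  exact (subset_erase.mp (mem_powersetCard.mp hX).1).2

theorem link_self (hA : A ∈ matrices n) (j : Fin n) (x : Fin n → ℝ) : link A j x j = 0 := by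
  simp [link, hA.1 j]

theorem link_update (hA : A ∈ matrices n) (j : Fin n) (x : Fin n → ℝ) (a : ℝ) :
    link A j (Function.update x j a) = link A j x := by
  ext i
  by_cases h : i = j
  · subst h; simp [link, hA.1 i]
  · simp [link, h]

/-- `L_{r+1}` is affine in the weight of `j`, with slope `L_r` of the link of `j`. -/
theorem L_succ_split (hA : A ∈ matrices n) (r : ℕ) (x : Fin n → ℝ) (j : Fin n) :
    L (r + 1) A x = L (r + 1) A (Function.update x j 0) + x j * L r A (link A j x) := by
  classical
  rw [L_eq_sum_erase (by simp : Function.update x j 0 j = 0),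
    L_eq_sum_erase (link_self hA j x), L_eq_sum_edgeProd]
  have hj : j ∉ (univ : Finset (Fin n)).erase j := notMem_erase _ _
  have hins : insert j ((univ : Finset (Fin n)).erase j) = univ := insert_erase (mem_univ j)
  conv_lhs => rw [← hins, powersetCard_succ_insert hj]
  have hnot : ∀ {k : ℕ} {X : Finset (Fin n)}, X ∈ powersetCard k (univ.erase j) → j ∉ X :=
    fun hX => (subset_erase.mp (mem_powersetCard.mp hX).1).2
  rw [sum_union, sum_image]
  · congr 1
    · refine sum_congr rfl fun X hX => ?_
      congr 1
      refine prod_congr rfl fun i hi => ?_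
      rw [Function.update_of_ne]
      exact fun h => hnot hX (h ▸ hi)
    · rw [mul_sum]
      refine sum_congr rfl fun X hX => ?_
      rw [edgeProd_insert hA (hnot hX), prod_insert (hnot hX)]
      simp only [link, prod_mul_distrib]
      ring
  · intro X hX Y hY h
    rw [← erase_insert (hnot hX), ← erase_insert (hnot hY), h]
  · rw [Finset.disjoint_left]
    intro X hX hX'
    obtain ⟨Y, -, rfl⟩ := mem_image.mp hX'
    exact hnot hX (mem_insert_self _ _)

theorem L_zero (A : Matrix (Fin n) (Fin n) ℝ) (x : Fin n → ℝ) : L 0 A x = 1 := by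
  simp [L]

theorem L_one (A : Matrix (Fin n) (Fin n) ℝ) (x : Fin n → ℝ) : L 1 A x = ∑ i, x i := by
  simp [L, powersetCard_one, filter_singleton]

theorem L_nonneg (hA : A ∈ matrices n) (hx : ∀ i, 0 ≤ x i) (r : ℕ) : 0 ≤ L r A x :=
  sum_nonneg fun X _ => mul_nonneg (edgeProd_nonneg hA X) (prod_nonneg fun i _ => hx i)

theorem L_smul (r : ℕ) (A : Matrix (Fin n) (Fin n) ℝ) (x : Fin n → ℝ) (a : ℝ) :
    L r A (fun i => a * x i) = a ^ r * L r A x := by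
  rw [L_eq_sum_edgeProd, L_eq_sum_edgeProd, mul_sum]
  refine sum_congr rfl fun X hX => ?_
  rw [prod_mul_distrib, prod_const, (mem_powersetCard.mp hX).2]
  ring

theorem L_update_zero (r : ℕ) (A : Matrix (Fin n) (Fin n) ℝ) (x : Fin n → ℝ) (j : Fin n) :
    L r A (Function.update x j 0) =
      ∑ X ∈ powersetCard r univ, if j ∈ X then 0 else edgeProd A X * ∏ i ∈ X, x i := by
  rw [L_eq_sum_edgeProd]
  refine sum_congr rfl fun X _ => ?_
  split_ifs with h
  · rw [prod_eq_zero h (by simp), mul_zero]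
  · congr 1
    refine prod_congr rfl fun i hi => ?_
    rw [Function.update_of_ne]
    exact fun h' => h (h' ▸ hi)

/-- Euler's identity: every `(r+1)`-clique is counted once from each of its vertices. -/
theorem sum_mul_L_link (hA : A ∈ matrices n) (r : ℕ) (x : Fin n → ℝ) :
    ∑ i, x i * L r A (link A i x) = (r + 1) * L (r + 1) A x := by
  have h : ∀ i, x i * L r A (link A i x) =
      ∑ X ∈ powersetCard (r + 1) univ, if i ∈ X then edgeProd A X * ∏ i ∈ X, x i else 0 := by
    intro i
    have := L_succ_split hA r x i
    rw [L_update_zero, L_eq_sum_edgeProd] at this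
    rw [← sub_eq_iff_eq_add', ← sum_sub_distrib] at this
    rw [← this]
    refine sum_congr rfl fun X _ => ?_
    split_ifs <;> simp
  simp_rw [h]
  rw [sum_comm, L_eq_sum_edgeProd, mul_sum]
  refine sum_congr rfl fun X hX => ?_
  rw [← sum_filter, sum_const, filter_mem_eq_inter, univ_inter, (mem_powersetCard.mp hX).2]
  simp

/-! ### Degrees, codegrees and clique inequalities -/

/-- The weighted degree `∑_j a_{ij} x_j`. -/
def deg (A : Matrix (Fin n) (Fin n) ℝ) (x : Fin n → ℝ) (i : Fin n) : ℝ := ∑ j, A i j * x j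

/-- The weighted codegree `∑_k a_{ik} a_{jk} x_k`. -/
def codeg (A : Matrix (Fin n) (Fin n) ℝ) (x : Fin n → ℝ) (i j : Fin n) : ℝ :=
  ∑ k, A i k * A j k * x k

/-- The weight `∑_l a_{il} a_{jl} a_{kl} x_l` of the common neighbourhood of three vertices. -/
def codegThree (A : Matrix (Fin n) (Fin n) ℝ) (x : Fin n → ℝ) (i j k : Fin n) : ℝ :=
  ∑ l, A i l * A j l * A k l * x l

/-- The weight of the ordered triangle `(i, j, k)`. -/
def triWeight (A : Matrix (Fin n) (Fin n) ℝ) (x : Fin n → ℝ) (i j k : Fin n) : ℝ :=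
  A i j * A i k * A j k * (x i * x j * x k)

/-- The sum of the squared codegrees over the ordered weighted edges. -/
def codegSq (A : Matrix (Fin n) (Fin n) ℝ) (x : Fin n → ℝ) : ℝ :=
  ∑ i, ∑ j, A i j * (x i * x j) * codeg A x i j ^ 2

theorem matrices_symm (hA : A ∈ matrices n) (i j : Fin n) : A i j = A j i := (hA.2 i j).2.1

theorem matrices_nonneg (hA : A ∈ matrices n) (i j : Fin n) : 0 ≤ A i j := (hA.2 i j).1

theorem matrices_le_one (hA : A ∈ matrices n) (i j : Fin n) : A i j ≤ 1 := (hA.2 j i).2.2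

theorem L_one_link (A : Matrix (Fin n) (Fin n) ℝ) (i : Fin n) (x : Fin n → ℝ) :
    L 1 A (link A i x) = deg A x i := L_one _ _

theorem link_nonneg (hA : A ∈ matrices n) (hx : ∀ i, 0 ≤ x i) (i j : Fin n) :
    0 ≤ link A i x j := mul_nonneg (matrices_nonneg hA i j) (hx j)

theorem deg_nonneg (hA : A ∈ matrices n) (hx : ∀ i, 0 ≤ x i) (i : Fin n) : 0 ≤ deg A x i :=
  sum_nonneg fun j _ => link_nonneg hA hx i j

theorem deg_le (hA : A ∈ matrices n) (hx : ∀ i, 0 ≤ x i) (i : Fin n) : deg A x i ≤ L 1 A x := by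
  rw [L_one]
  exact sum_le_sum fun j _ => mul_le_of_le_one_left (hx j) (matrices_le_one hA i j)

theorem sum_mul_deg (hA : A ∈ matrices n) (x : Fin n → ℝ) :
    ∑ i, x i * deg A x i = 2 * L 2 A x := by
  have := sum_mul_L_link hA 1 x
  simp only [L_one_link] at this
  rw [this]; norm_num

theorem sum_edges (hA : A ∈ matrices n) (x : Fin n → ℝ) :
    ∑ i, ∑ j, A i j * (x i * x j) = 2 * L 2 A x := by
  rw [← sum_mul_deg hA]
  refine sum_congr rfl fun i _ => ?_
  rw [deg, mul_sum]
  exact sum_congr rfl fun j _ => by ring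

theorem sum_mul_codeg (hA : A ∈ matrices n) (x : Fin n → ℝ) (i : Fin n) :
    ∑ j, A i j * x j * codeg A x i j = 2 * L 2 A (link A i x) := by
  rw [← sum_mul_deg hA]
  refine sum_congr rfl fun j _ => ?_
  simp only [codeg, deg, link]
  congr 1
  exact sum_congr rfl fun k _ => by ring

theorem sum_mul_L_two_link (hA : A ∈ matrices n) (x : Fin n → ℝ) :
    ∑ i, x i * L 2 A (link A i x) = 3 * L 3 A x := by
  rw [sum_mul_L_link hA]; norm_num

theorem sum_mul_L_three_link (hA : A ∈ matrices n) (x : Fin n → ℝ) :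
    ∑ i, x i * L 3 A (link A i x) = 4 * L 4 A x := by
  rw [sum_mul_L_link hA]; norm_num

theorem sum_edges_codeg (hA : A ∈ matrices n) (x : Fin n → ℝ) :
    ∑ i, ∑ j, A i j * (x i * x j) * codeg A x i j = 6 * L 3 A x := by
  have h : ∀ i, ∑ j, A i j * (x i * x j) * codeg A x i j = 2 * (x i * L 2 A (link A i x)) := by
    intro i
    rw [mul_left_comm, ← sum_mul_codeg hA, mul_sum]
    exact sum_congr rfl fun j _ => by ring
  simp_rw [h]
  rw [← mul_sum, sum_mul_L_two_link hA]; ring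

theorem sum_triWeight_right (A : Matrix (Fin n) (Fin n) ℝ) (x : Fin n → ℝ) (i j : Fin n) :
    ∑ k, triWeight A x i j k = A i j * (x i * x j) * codeg A x i j := by
  rw [codeg, mul_sum]
  exact sum_congr rfl fun k _ => by simp only [triWeight]; ring

theorem sum_triWeight (hA : A ∈ matrices n) (x : Fin n → ℝ) :
    ∑ i, ∑ j, ∑ k, triWeight A x i j k = 6 * L 3 A x := by
  simp_rw [sum_triWeight_right]
  exact sum_edges_codeg hA x

theorem triWeight_nonneg (hA : A ∈ matrices n) (hx : ∀ i, 0 ≤ x i) (i j k : Fin n) :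
    0 ≤ triWeight A x i j k := by
  have := matrices_nonneg hA
  exact mul_nonneg (mul_nonneg (mul_nonneg (this _ _) (this _ _)) (this _ _))
    (mul_nonneg (mul_nonneg (hx _) (hx _)) (hx _))

theorem triWeight_swap_left (hA : A ∈ matrices n) (x : Fin n → ℝ) (i j k : Fin n) :
    triWeight A x j i k = triWeight A x i j k := by
  simp only [triWeight]; rw [matrices_symm hA j i]; ring

theorem triWeight_swap_right (hA : A ∈ matrices n) (x : Fin n → ℝ) (i j k : Fin n) :
    triWeight A x i k j = triWeight A x i j k := by
  simp only [triWeight]; rw [matrices_symm hA k j]; ring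

/-- Sums over ordered triangles may be transposed in the first two vertices. -/
theorem sum_triWeight_swap_left (hA : A ∈ matrices n) (x : Fin n → ℝ)
    (f : Fin n → Fin n → Fin n → ℝ) :
    ∑ i, ∑ j, ∑ k, triWeight A x i j k * f j i k =
      ∑ i, ∑ j, ∑ k, triWeight A x i j k * f i j k := by
  rw [sum_comm]
  simp_rw [triWeight_swap_left hA]

/-- Sums over ordered triangles may be transposed in the last two vertices. -/
theorem sum_triWeight_swap_right (hA : A ∈ matrices n) (x : Fin n → ℝ)
    (f : Fin n → Fin n → Fin n → ℝ) :
    ∑ i, ∑ j, ∑ k, triWeight A x i j k * f i k j =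
      ∑ i, ∑ j, ∑ k, triWeight A x i j k * f i j k := by
  refine sum_congr rfl fun i _ => ?_
  rw [sum_comm]
  simp_rw [triWeight_swap_right hA]

theorem sum_triWeight_vertex (hA : A ∈ matrices n) (x g : Fin n → ℝ) :
    ∑ i, ∑ j, ∑ k, triWeight A x i j k * (g i + g j + g k) =
      6 * ∑ i, x i * (g i * L 2 A (link A i x)) := by
  have h1 : ∑ i, ∑ j, ∑ k, triWeight A x i j k * g i =
      2 * ∑ i, x i * (g i * L 2 A (link A i x)) := by
    rw [mul_sum]
    refine sum_congr rfl fun i _ => ?_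
    simp_rw [← sum_mul, sum_triWeight_right]
    rw [show 2 * (x i * (g i * L 2 A (link A i x))) = x i * (2 * L 2 A (link A i x)) * g i by ring,
      ← sum_mul_codeg hA, mul_sum]
    congr 1
    exact sum_congr rfl fun j _ => by ring
  have h2 := sum_triWeight_swap_left hA x fun i _ _ => g i
  have h3 := sum_triWeight_swap_right hA x fun _ j _ => g j
  simp_rw [mul_add, sum_add_distrib]
  rw [h3, h2, h1]; ring

theorem sum_triWeight_edge (hA : A ∈ matrices n) (x : Fin n → ℝ) (g : Fin n → Fin n → ℝ) :
    ∑ i, ∑ j, ∑ k, triWeight A x i j k * (g i j + g i k + g j k) =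
      3 * ∑ i, ∑ j, A i j * (x i * x j) * codeg A x i j * g i j := by
  have h1 : ∑ i, ∑ j, ∑ k, triWeight A x i j k * g i j =
      ∑ i, ∑ j, A i j * (x i * x j) * codeg A x i j * g i j := by
    simp_rw [← sum_mul, sum_triWeight_right]
  have h2 := sum_triWeight_swap_right hA x fun i j _ => g i j
  have h3 := sum_triWeight_swap_left hA x fun i _ k => g i k
  simp_rw [mul_add, sum_add_distrib]
  rw [h3, h2, h1]; ring

theorem codeg_symm (A : Matrix (Fin n) (Fin n) ℝ) (x : Fin n → ℝ) (i j : Fin n) :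
    codeg A x i j = codeg A x j i :=
  sum_congr rfl fun k _ => by ring

theorem sum_triWeight_codeg (hA : A ∈ matrices n) (x : Fin n → ℝ) :
    ∑ i, ∑ j, ∑ k, triWeight A x i j k * (codeg A x i j + codeg A x i k + codeg A x j k) =
      3 * codegSq A x := by
  rw [sum_triWeight_edge hA x (codeg A x), codegSq]
  congr 1
  exact sum_congr rfl fun i _ => sum_congr rfl fun j _ => by ring

theorem sum_triWeight_codegThree (hA : A ∈ matrices n) (x : Fin n → ℝ) :
    ∑ i, ∑ j, ∑ k, triWeight A x i j k * codegThree A x i j k = 24 * L 4 A x := by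
  rw [show 24 * L 4 A x = 6 * (4 * L 4 A x) by ring, ← sum_mul_L_three_link hA, mul_sum]
  refine sum_congr rfl fun i _ => ?_
  rw [mul_left_comm, ← sum_triWeight hA, mul_sum]
  refine sum_congr rfl fun j _ => ?_
  rw [mul_sum]
  refine sum_congr rfl fun k _ => ?_
  rw [codegThree, mul_sum, mul_sum]
  exact sum_congr rfl fun l _ => by simp only [triWeight, link]; ring

/-- The weight of the vertices non-adjacent to both `i` and `j`. -/
theorem sum_mul_one_sub_mul_one_sub (A : Matrix (Fin n) (Fin n) ℝ) (x : Fin n → ℝ) (i j : Fin n) :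
    ∑ k, x k * ((1 - A i k) * (1 - A j k)) =
      L 1 A x - deg A x i - deg A x j + codeg A x i j := by
  rw [L_one, deg, deg, codeg, ← sum_sub_distrib, ← sum_sub_distrib, ← sum_add_distrib]
  exact sum_congr rfl fun k _ => by ring

theorem one_sub_deg_sub_deg_add_codeg_nonneg (hA : A ∈ matrices n) (hx : ∀ i, 0 ≤ x i)
    (i j : Fin n) : 0 ≤ L 1 A x - deg A x i - deg A x j + codeg A x i j := by
  rw [← sum_mul_one_sub_mul_one_sub]
  exact sum_nonneg fun k _ => mul_nonneg (hx k) (mul_nonneg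
    (sub_nonneg.mpr (matrices_le_one hA i k)) (sub_nonneg.mpr (matrices_le_one hA j k)))

theorem sum_edges_deg (hA : A ∈ matrices n) (x : Fin n → ℝ) :
    ∑ i, ∑ j, A i j * (x i * x j) * (deg A x i + deg A x j) = 2 * ∑ i, x i * deg A x i ^ 2 := by
  have h1 : ∑ i, ∑ j, A i j * (x i * x j) * deg A x i = ∑ i, x i * deg A x i ^ 2 := by
    refine sum_congr rfl fun i _ => ?_
    rw [show x i * deg A x i ^ 2 = x i * deg A x i * deg A x i by ring]
    nth_rw 3 [deg]
    rw [mul_sum]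
    exact sum_congr rfl fun j _ => by ring
  have h2 : ∑ i, ∑ j, A i j * (x i * x j) * deg A x j =
      ∑ i, ∑ j, A i j * (x i * x j) * deg A x i := by
    rw [sum_comm]
    refine sum_congr rfl fun i _ => sum_congr rfl fun j _ => ?_
    rw [matrices_symm hA j i]; ring
  simp_rw [mul_add, sum_add_distrib]
  rw [h2, h1]; ring

theorem sum_edges_codeg_deg (hA : A ∈ matrices n) (x : Fin n → ℝ) :
    ∑ i, ∑ j, A i j * (x i * x j) * codeg A x i j * (deg A x i + deg A x j) =
      4 * ∑ i, x i * (deg A x i * L 2 A (link A i x)) := by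
  have h1 : ∑ i, ∑ j, A i j * (x i * x j) * codeg A x i j * deg A x i =
      2 * ∑ i, x i * (deg A x i * L 2 A (link A i x)) := by
    rw [mul_sum]
    refine sum_congr rfl fun i _ => ?_
    rw [show 2 * (x i * (deg A x i * L 2 A (link A i x))) =
      x i * deg A x i * (2 * L 2 A (link A i x)) by ring, ← sum_mul_codeg hA, mul_sum]
    exact sum_congr rfl fun j _ => by ring
  have h2 : ∑ i, ∑ j, A i j * (x i * x j) * codeg A x i j * deg A x j =
      ∑ i, ∑ j, A i j * (x i * x j) * codeg A x i j * deg A x i := by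
    rw [sum_comm]
    refine sum_congr rfl fun i _ => sum_congr rfl fun j _ => ?_
    rw [matrices_symm hA j i, codeg_symm A x j i]; ring
  simp_rw [mul_add, sum_add_distrib]
  rw [h2, h1]; ring

/-- The Goodman bound `L_3 ≥ L_2 (4 L_2 - L_1²) / (3 L_1)`. -/
theorem goodman (hA : A ∈ matrices n) (hx : ∀ i, 0 ≤ x i) :
    L 2 A x * (4 * L 2 A x - L 1 A x ^ 2) ≤ 3 * L 1 A x * L 3 A x := by
  have hS : 0 ≤ L 1 A x := L_nonneg hA hx 1
  have h0 : 0 ≤ ∑ i, ∑ j, A i j * (x i * x j) *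
      (L 1 A x - deg A x i - deg A x j + codeg A x i j) :=
    sum_nonneg fun i _ => sum_nonneg fun j _ => mul_nonneg
      (mul_nonneg (matrices_nonneg hA i j) (mul_nonneg (hx i) (hx j)))
      (one_sub_deg_sub_deg_add_codeg_nonneg hA hx i j)
  have h1 : ∑ i, ∑ j, A i j * (x i * x j) *
      (L 1 A x - deg A x i - deg A x j + codeg A x i j) =
      2 * L 2 A x * L 1 A x - 2 * ∑ i, x i * deg A x i ^ 2 + 6 * L 3 A x := by
    rw [← sum_edges_codeg hA, ← sum_edges_deg hA, ← sum_edges hA]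
    simp_rw [sum_mul, ← sum_sub_distrib, ← sum_add_distrib]
    exact sum_congr rfl fun i _ => sum_congr rfl fun j _ => by ring
  have h2 : (2 * L 2 A x) ^ 2 ≤ L 1 A x * ∑ i, x i * deg A x i ^ 2 := by
    rw [← sum_mul_deg hA, L_one]
    refine sum_sq_le_sum_mul_sum_of_sq_le_mul _ (fun i _ => hx i)
      (fun i _ => mul_nonneg (hx i) (sq_nonneg _)) fun i _ => le_of_eq (by ring)
  nlinarith [mul_nonneg hS h0]

/-- Sum over triangles `ijk` and vertices `l` of the nonnegative weight
`(1 - a_{il}) (1 - a_{jl}) (1 - a_{kl})`, expanded by inclusion–exclusion. -/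
theorem four_L_four_le (hA : A ∈ matrices n) (hx : ∀ i, 0 ≤ x i) :
    4 * L 4 A x - L 1 A x * L 3 A x + ∑ i, x i * (deg A x i * L 2 A (link A i x)) ≤
      codegSq A x / 2 := by
  have h0 : ∀ i j k, 0 ≤ L 1 A x - (deg A x i + deg A x j + deg A x k) +
      (codeg A x i j + codeg A x i k + codeg A x j k) - codegThree A x i j k := by
    intro i j k
    have h1 : ∑ l, x l * ((1 - A i l) * (1 - A j l) * (1 - A k l)) =
        L 1 A x - (deg A x i + deg A x j + deg A x k) +
        (codeg A x i j + codeg A x i k + codeg A x j k) - codegThree A x i j k := by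
      simp only [L_one, deg, codeg, codegThree, ← sum_sub_distrib, ← sum_add_distrib]
      exact sum_congr rfl fun l _ => by ring
    rw [← h1]
    have := matrices_le_one hA
    exact sum_nonneg fun l _ => mul_nonneg (hx l) (mul_nonneg (mul_nonneg
      (sub_nonneg.mpr (this _ _)) (sub_nonneg.mpr (this _ _))) (sub_nonneg.mpr (this _ _)))
  have h2 : 0 ≤ ∑ i, ∑ j, ∑ k, triWeight A x i j k *
      (L 1 A x - (deg A x i + deg A x j + deg A x k) +
        (codeg A x i j + codeg A x i k + codeg A x j k) - codegThree A x i j k) :=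
    sum_nonneg fun i _ => sum_nonneg fun j _ => sum_nonneg fun k _ =>
      mul_nonneg (triWeight_nonneg hA hx i j k) (h0 i j k)
  simp_rw [mul_sub, mul_add _ (_ - _), mul_sub, sum_sub_distrib, sum_add_distrib,
    sum_sub_distrib, sum_triWeight_vertex hA, sum_triWeight_codeg hA, sum_triWeight_codegThree hA,
    ← sum_mul, sum_triWeight hA] at h2
  linarith

/-- A lower bound for `L_4` in terms of the squared codegrees, from the inequality
`2uvw - uv - uw - vw + 1 ≥ 0` on `[0, 1]³`. -/
theorem three_codegSq_le (hA : A ∈ matrices n) (hx : ∀ i, 0 ≤ x i) :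
    3 * codegSq A x ≤ 6 * L 3 A x * L 1 A x + 48 * L 4 A x := by
  have h0 : ∀ i j k, 0 ≤ L 1 A x - (codeg A x i j + codeg A x i k + codeg A x j k) +
      2 * codegThree A x i j k := by
    intro i j k
    have h1 : ∑ l, x l * ((1 - A i l) * (1 - A j l * A k l) + A i l * ((1 - A j l) * (1 - A k l)))
        = L 1 A x - (codeg A x i j + codeg A x i k + codeg A x j k) +
          2 * codegThree A x i j k := by
      simp only [L_one, codeg, codegThree, mul_sum, ← sum_sub_distrib, ← sum_add_distrib]
      exact sum_congr rfl fun l _ => by ring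
    rw [← h1]
    have h := matrices_le_one hA
    have h' := matrices_nonneg hA
    exact sum_nonneg fun l _ => mul_nonneg (hx l) (add_nonneg
      (mul_nonneg (sub_nonneg.mpr (h _ _)) (sub_nonneg.mpr (mul_le_one₀ (h _ _) (h' _ _) (h _ _))))
      (mul_nonneg (h' _ _) (mul_nonneg (sub_nonneg.mpr (h _ _)) (sub_nonneg.mpr (h _ _)))))
  have h2 : 0 ≤ ∑ i, ∑ j, ∑ k, triWeight A x i j k *
      (L 1 A x - (codeg A x i j + codeg A x i k + codeg A x j k) +
        2 * codegThree A x i j k) :=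
    sum_nonneg fun i _ => sum_nonneg fun j _ => sum_nonneg fun k _ =>
      mul_nonneg (triWeight_nonneg hA hx i j k) (h0 i j k)
  simp_rw [mul_add _ (_ - _), mul_sub, mul_left_comm _ (2 : ℝ), sum_add_distrib, sum_sub_distrib,
    sum_triWeight_codeg hA, ← mul_sum, sum_triWeight_codegThree hA,
    ← sum_mul, sum_triWeight hA] at h2
  linarith

/-- Cauchy–Schwarz for the codegrees of the edges. -/
theorem sq_L_three_le (hA : A ∈ matrices n) (hx : ∀ i, 0 ≤ x i) :
    (6 * L 3 A x) ^ 2 ≤ 2 * L 2 A x * codegSq A x := by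
  have he : ∀ i j, 0 ≤ A i j * (x i * x j) := fun i j =>
    mul_nonneg (matrices_nonneg hA i j) (mul_nonneg (hx i) (hx j))
  rw [← sum_edges_codeg hA, ← sum_edges hA, codegSq]
  simp_rw [← sum_product']
  exact sum_sq_le_sum_mul_sum_of_sq_le_mul _ (fun p _ => he _ _)
    (fun p _ => mul_nonneg (he _ _) (sq_nonneg _)) fun p _ => le_of_eq (by ring)

/-! ### Perturbations -/

/-- The form after moving to the point `(1 - ε) x + ε e_j`. -/
theorem L_succ_convex_single (hA : A ∈ matrices n) (r : ℕ) (x : Fin n → ℝ) (j : Fin n) (ε : ℝ) :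
    L (r + 1) A (fun i => (1 - ε) * x i + if i = j then ε else 0) =
      (1 - ε) ^ (r + 1) * L (r + 1) A x + ε * ((1 - ε) ^ r * L r A (link A j x)) := by
  set y : Fin n → ℝ := fun i => (1 - ε) * x i with hy
  have hxy : (fun i => (1 - ε) * x i + if i = j then ε else 0) =
      Function.update y j (y j + ε) := by
    ext i
    by_cases h : i = j
    · subst h; simp [hy]
    · simp [h, hy]
  have hl : link A j y = fun i => (1 - ε) * link A j x i := by
    ext i; simp only [hy, link]; ring
  rw [hxy, L_succ_split hA r _ j, link_update hA, Function.update_idem, Function.update_self,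
    ← L_smul (r + 1), ← L_smul r, ← hl, ← hy, L_succ_split hA r y j]
  ring

/-- The matrix `A` with row and column `j` multiplied by `1 - ε`. -/
def scaleRow (A : Matrix (Fin n) (Fin n) ℝ) (j : Fin n) (ε : ℝ) : Matrix (Fin n) (Fin n) ℝ :=
  Matrix.of fun a b => if a = j ∨ b = j then (1 - ε) * A a b else A a b

theorem scaleRow_mem (hA : A ∈ matrices n) (j : Fin n) {ε : ℝ} (h0 : 0 ≤ ε) (h1 : ε ≤ 1) :
    scaleRow A j ε ∈ matrices n := by
  refine ⟨fun i => ?_, fun a b => ⟨?_, ?_, ?_⟩⟩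
  · simp [scaleRow, hA.1 i]
  · simp only [scaleRow, Matrix.of_apply]
    split_ifs
    · exact mul_nonneg (by linarith) (matrices_nonneg hA _ _)
    · exact matrices_nonneg hA _ _
  · simp only [scaleRow, Matrix.of_apply, or_comm, matrices_symm hA a b]
  · simp only [scaleRow, Matrix.of_apply]
    split_ifs
    · exact mul_le_one₀ (by linarith) (matrices_nonneg hA _ _) (matrices_le_one hA _ _)
    · exact matrices_le_one hA _ _

theorem L_succ_scaleRow (hA : A ∈ matrices n) (r : ℕ) (x : Fin n → ℝ) (j : Fin n) {ε : ℝ}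
    (h0 : 0 ≤ ε) (h1 : ε ≤ 1) :
    L (r + 1) (scaleRow A j ε) x =
      L (r + 1) A x + ((1 - ε) ^ r - 1) * (x j * L r A (link A j x)) := by
  have hB := scaleRow_mem hA j h0 h1
  have hAB : ∀ a b, a ≠ j → b ≠ j → scaleRow A j ε a b = A a b := fun a b ha hb => by
    simp [scaleRow, ha, hb]
  have hl : link (scaleRow A j ε) j x = fun i => (1 - ε) * link A j x i := by
    ext i; simp only [link, scaleRow, Matrix.of_apply, true_or, if_true]; ring
  have hz : (fun i => (1 - ε) * link A j x i) j = 0 := by simp [link_self hA]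
  rw [L_succ_split hB r x j, L_succ_split hA r x j, hl,
    L_congr_of_apply_eq_zero hAB (by simp : Function.update x j 0 j = 0),
    L_congr_of_apply_eq_zero hAB hz, L_smul]
  ring

/-- The matrix with entries `a_{ij} (1 - ε w_{ij})`. -/
def scaleEntries (A : Matrix (Fin n) (Fin n) ℝ) (w : Fin n → Fin n → ℝ) (ε : ℝ) :
    Matrix (Fin n) (Fin n) ℝ :=
  Matrix.of fun i j => A i j * (1 - ε * w i j)

theorem scaleEntries_mem (hA : A ∈ matrices n) {w : Fin n → Fin n → ℝ}
    (hw : ∀ i j, w i j = w j i) (hw0 : ∀ i j, 0 ≤ w i j) (hw1 : ∀ i j, w i j ≤ 1) {ε : ℝ}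
    (h0 : 0 ≤ ε) (h1 : ε ≤ 1) : scaleEntries A w ε ∈ matrices n := by
  have h : ∀ i j, 0 ≤ 1 - ε * w i j := fun i j =>
    sub_nonneg.mpr (mul_le_one₀ h1 (hw0 i j) (hw1 i j))
  refine ⟨fun i => by simp [scaleEntries, hA.1 i], fun a b => ⟨?_, ?_, ?_⟩⟩
  · exact mul_nonneg (matrices_nonneg hA _ _) (h a b)
  · simp only [scaleEntries, Matrix.of_apply, matrices_symm hA a b, hw a b]
  · exact mul_le_one₀ (matrices_le_one hA _ _) (h b a)
      (by linarith [mul_nonneg h0 (hw0 b a)])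

theorem L_two_scaleEntries (hA : A ∈ matrices n) (x : Fin n → ℝ) {w : Fin n → Fin n → ℝ} {ε : ℝ}
    (hB : scaleEntries A w ε ∈ matrices n) :
    L 2 (scaleEntries A w ε) x =
      L 2 A x + ε * (-(1 / 2) * ∑ i, ∑ j, A i j * (x i * x j) * w i j) := by
  have h1 := sum_edges hB x
  have h2 : ∑ i, ∑ j, scaleEntries A w ε i j * (x i * x j) =
      2 * L 2 A x - ε * ∑ i, ∑ j, A i j * (x i * x j) * w i j := by
    rw [← sum_edges hA]
    simp_rw [mul_sum, ← sum_sub_distrib]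
    exact sum_congr rfl fun i _ => sum_congr rfl fun j _ => by
      simp only [scaleEntries, Matrix.of_apply]; ring
  linarith

theorem L_three_scaleEntries (x : Fin n → ℝ) {w : Fin n → Fin n → ℝ} {ε : ℝ}
    (hB : scaleEntries A w ε ∈ matrices n) :
    L 3 (scaleEntries A w ε) x = 1 / 6 * ∑ i, ∑ j, ∑ k, triWeight A x i j k *
      ((1 - ε * w i j) * (1 - ε * w i k) * (1 - ε * w j k)) := by
  rw [eq_comm, ← mul_right_inj' (by norm_num : (6 : ℝ) ≠ 0), ← sum_triWeight hB, ← mul_assoc]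
  norm_num
  refine sum_congr rfl fun i _ => sum_congr rfl fun j _ => sum_congr rfl fun k _ => ?_
  simp only [triWeight, scaleEntries, Matrix.of_apply]; ring

theorem hasDerivAt_L_three_scaleEntries (hA : A ∈ matrices n) (x : Fin n → ℝ)
    (w : Fin n → Fin n → ℝ) :
    HasDerivAt (fun ε : ℝ => 1 / 6 * ∑ i, ∑ j, ∑ k, triWeight A x i j k *
        ((1 - ε * w i j) * (1 - ε * w i k) * (1 - ε * w j k)))
      (-(1 / 2) * ∑ i, ∑ j, A i j * (x i * x j) * codeg A x i j * w i j) 0 := by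
  have h : ∀ a b c d : ℝ, HasDerivAt
      (fun ε : ℝ => a * ((1 - ε * b) * (1 - ε * c) * (1 - ε * d))) (-(a * (b + c + d))) 0 := by
    intro a b c d
    have hb : ∀ b : ℝ, HasDerivAt (fun ε : ℝ => 1 - ε * b) (-b) 0 := fun b => by
      simpa using ((hasDerivAt_id (0 : ℝ)).mul_const b).const_sub 1
    refine ((((hb b).fun_mul (hb c)).fun_mul (hb d)).const_mul a).congr_deriv ?_
    ring
  have hs : HasDerivAt (fun ε : ℝ => 1 / 6 * ∑ i, ∑ j, ∑ k, triWeight A x i j k *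
        ((1 - ε * w i j) * (1 - ε * w i k) * (1 - ε * w j k)))
      (1 / 6 * ∑ i, ∑ j, ∑ k, -(triWeight A x i j k * (w i j + w i k + w j k))) 0 :=
    (HasDerivAt.fun_sum fun i _ => HasDerivAt.fun_sum fun j _ => HasDerivAt.fun_sum fun k _ =>
      h _ _ _ _).const_mul _
  refine hs.congr_deriv ?_
  simp_rw [sum_neg_distrib]
  rw [sum_triWeight_edge hA x]; ring

/-! ### First-order conditions at a minimiser -/

/-- One-sided first-order condition: if `u - Φ ∘ v` has a right minimum at `0`, then `u' ≥ Φ' v'`. -/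
theorem mul_le_of_right_minimum {Φ u v : ℝ → ℝ} {μ u' v' : ℝ} (hu : HasDerivAt u u' 0)
    (hv : HasDerivAt v v' 0) (hΦ : HasDerivAt Φ μ (v 0))
    (hmin : ∀ᶠ ε in 𝓝[>] (0 : ℝ), u 0 - Φ (v 0) ≤ u ε - Φ (v ε)) : μ * v' ≤ u' := by
  have hd : HasDerivAt (fun ε => u ε - Φ (v ε)) (u' - μ * v') 0 := hu.sub (hΦ.comp 0 hv)
  have := hd.tendsto_slope_zero_right
  refine sub_nonneg.mp (ge_of_tendsto this ?_)
  filter_upwards [hmin, self_mem_nhdsWithin] with ε hε hpos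
  have hpos : 0 < ε := hpos
  simp only [zero_add, smul_eq_mul]
  exact mul_nonneg (inv_nonneg.mpr hpos.le) (sub_nonneg.mpr hε)

/-- `(A, x)` satisfies the first-order conditions for minimising `L_r - μ L_2` over pairs with
`L_1 = 1`: along every path of such pairs on which `L_r` and `L_2` are differentiable at the start,
the derivative of `L_r - μ L_2` is nonnegative.  The path enters only through the values
`u` of `L_r` and `v` of `L_2` on it. -/
def FirstOrder (r : ℕ) (A : Matrix (Fin n) (Fin n) ℝ) (x : Fin n → ℝ) (μ : ℝ) : Prop :=
  ∀ (u v : ℝ → ℝ) (u' v' : ℝ), HasDerivAt u u' 0 → HasDerivAt v v' 0 →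
    u 0 = L r A x → v 0 = L 2 A x →
    (∀ ε ∈ Set.Icc (0 : ℝ) 1, ∃ B ∈ matrices n, ∃ y : Fin n → ℝ, (∀ i, 0 ≤ y i) ∧
      L 1 B y = 1 ∧ L r B y = u ε ∧ L 2 B y = v ε) → μ * v' ≤ u'

theorem hasDerivAt_convex_single (r : ℕ) (a b : ℝ) :
    HasDerivAt (fun ε : ℝ => (1 - ε) ^ (r + 1) * a + ε * ((1 - ε) ^ r * b))
      (b - (r + 1) * a) 0 := by
  have h1 : HasDerivAt (fun ε : ℝ => 1 - ε) (-1) 0 := by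
    simpa using (hasDerivAt_id (0 : ℝ)).const_sub 1
  refine (((h1.fun_pow (r + 1)).mul_const a).fun_add
    ((hasDerivAt_id' (0 : ℝ)).fun_mul ((h1.fun_pow r).mul_const b))).congr_deriv ?_
  simp; ring

theorem FirstOrder.le_link {r : ℕ} {μ : ℝ} (h : FirstOrder (r + 1) A x μ) (hA : A ∈ matrices n)
    (hx : ∀ i, 0 ≤ x i) (h1 : L 1 A x = 1) (j : Fin n) :
    (r + 1) * L (r + 1) A x - 2 * μ * L 2 A x ≤ L r A (link A j x) - μ * deg A x j := by
  have := h _ _ _ _ (hasDerivAt_convex_single r (L (r + 1) A x) (L r A (link A j x)))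
    (hasDerivAt_convex_single 1 (L 2 A x) (L 1 A (link A j x))) (by simp) (by simp) ?_
  · rw [L_one_link] at this
    push_cast at this
    linarith
  · intro ε hε
    refine ⟨A, hA, fun i => (1 - ε) * x i + if i = j then ε else 0, fun i => ?_, ?_, ?_, ?_⟩
    · have := mul_nonneg (sub_nonneg.mpr hε.2) (hx i)
      dsimp only
      split_ifs <;> linarith [hε.1]
    · rw [L_succ_convex_single hA 0, L_zero, zero_add, h1]; ring
    · exact L_succ_convex_single hA r x j ε
    · exact L_succ_convex_single hA 1 x j ε

/-- Averaging the inequalities `FirstOrder.le_link` gives equality, so each of them is sharp. -/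
theorem FirstOrder.link_eq {r : ℕ} {μ : ℝ} (h : FirstOrder (r + 1) A x μ) (hA : A ∈ matrices n)
    (hx : ∀ i, 0 ≤ x i) (h1 : L 1 A x = 1) {j : Fin n} (hj : 0 < x j) :
    L r A (link A j x) = μ * deg A x j + ((r + 1) * L (r + 1) A x - 2 * μ * L 2 A x) := by
  set lam := (r + 1) * L (r + 1) A x - 2 * μ * L 2 A x with hlam
  have h0 : ∀ i ∈ univ, 0 ≤ x i * (L r A (link A i x) - μ * deg A x i - lam) := fun i _ =>
    mul_nonneg (hx i) (sub_nonneg.mpr (h.le_link hA hx h1 i))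
  have hs : ∑ i, x i * (L r A (link A i x) - μ * deg A x i - lam) = 0 := by
    have e : ∀ i, x i * (L r A (link A i x) - μ * deg A x i - lam) =
        x i * L r A (link A i x) - μ * (x i * deg A x i) - lam * x i := fun i => by ring
    simp_rw [e, sum_sub_distrib, ← mul_sum, sum_mul_L_link hA, sum_mul_deg hA, ← L_one A x, h1]
    rw [hlam]; ring
  have := (sum_eq_zero_iff_of_nonneg h0).mp hs j (mem_univ j)
  rcases mul_eq_zero.mp this with h' | h'
  · exact absurd h' hj.ne'
  · linarith

theorem FirstOrder.link_le {r : ℕ} {μ : ℝ} (h : FirstOrder (r + 1) A x μ) (hA : A ∈ matrices n)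
    (hx : ∀ i, 0 ≤ x i) (h1 : L 1 A x = 1) {j : Fin n} (hj : 0 < x j) :
    r * L r A (link A j x) ≤ μ * deg A x j := by
  have hd : ∀ (k : ℕ) (a b : ℝ), HasDerivAt (fun ε : ℝ => a + ((1 - ε) ^ k - 1) * b)
      (-(k * b)) 0 := by
    intro k a b
    have h1 : HasDerivAt (fun ε : ℝ => 1 - ε) (-1) 0 := by
      simpa using (hasDerivAt_id (0 : ℝ)).const_sub 1
    refine ((((h1.fun_pow k).sub_const 1).mul_const b).const_add a).congr_deriv ?_
    simp
  have := h _ _ _ _ (hd r (L (r + 1) A x) (x j * L r A (link A j x)))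
    (hd 1 (L 2 A x) (x j * L 1 A (link A j x))) (by simp) (by simp) ?_
  · rw [L_one_link] at this
    push_cast at this
    refine le_of_mul_le_mul_left ?_ hj
    linarith
  · intro ε hε
    refine ⟨_, scaleRow_mem hA j hε.1 hε.2, x, hx, ?_, L_succ_scaleRow hA r x j hε.1 hε.2,
      L_succ_scaleRow hA 1 x j hε.1 hε.2⟩
    rw [L_one, ← L_one A, h1]

/-- The first-order condition for lowering every entry `a_{ij}` in proportion to the weight
`w_{ij}` of the common non-neighbours of `i` and `j`. -/
theorem FirstOrder.sum_edges_mul_le {μ : ℝ} (h : FirstOrder 3 A x μ) (hA : A ∈ matrices n)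
    (hx : ∀ i, 0 ≤ x i) (h1 : L 1 A x = 1) :
    ∑ i, ∑ j, A i j * (x i * x j) * codeg A x i j *
        (1 - deg A x i - deg A x j + codeg A x i j) ≤
      μ * ∑ i, ∑ j, A i j * (x i * x j) * (1 - deg A x i - deg A x j + codeg A x i j) := by
  set w : Fin n → Fin n → ℝ := fun i j => 1 - deg A x i - deg A x j + codeg A x i j with hw
  have hw0 : ∀ i j, 0 ≤ w i j := fun i j => by
    have := one_sub_deg_sub_deg_add_codeg_nonneg hA hx i j
    rwa [h1] at this
  have hw1 : ∀ i j, w i j ≤ 1 := fun i j => by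
    have h2 : codeg A x i j ≤ deg A x i := sum_le_sum fun k _ =>
      mul_le_mul_of_nonneg_right
        (mul_le_of_le_one_right (matrices_nonneg hA i k) (matrices_le_one hA j k)) (hx k)
    have h3 := deg_nonneg hA hx j
    simp only [hw]; linarith
  have hws : ∀ i j, w i j = w j i := fun i j => by
    simp only [hw, codeg_symm A x i j]; ring
  have hB : ∀ ε ∈ Set.Icc (0 : ℝ) 1, scaleEntries A w ε ∈ matrices n := fun ε hε =>
    scaleEntries_mem hA hws hw0 hw1 hε.1 hε.2
  have hd : HasDerivAt (fun ε : ℝ => L 2 A x + ε * (-(1 / 2) *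
      ∑ i, ∑ j, A i j * (x i * x j) * w i j))
      (-(1 / 2) * ∑ i, ∑ j, A i j * (x i * x j) * w i j) 0 := by
    refine (((hasDerivAt_id' (0 : ℝ)).mul_const _).const_add (L 2 A x)).congr_deriv ?_
    ring
  have := h _ _ _ _ (hasDerivAt_L_three_scaleEntries hA x w) hd ?_ (by simp) ?_
  · linarith
  · simp only [zero_mul, sub_zero, mul_one]
    rw [sum_triWeight hA]; ring
  · intro ε hε
    refine ⟨_, hB ε hε, x, hx, ?_, L_three_scaleEntries x (hB ε hε),
      L_two_scaleEntries hA x (hB ε hε)⟩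
    rw [L_one, ← L_one A, h1]

theorem continuous_L (n r : ℕ) :
    Continuous fun p : Matrix (Fin n) (Fin n) ℝ × (Fin n → ℝ) => L r p.1 p.2 := by
  have h1 : ∀ i j, Continuous fun p : Matrix (Fin n) (Fin n) ℝ × (Fin n → ℝ) => p.1 i j :=
    fun i j => continuous_fst.matrix_elem i j
  unfold L
  fun_prop

theorem isClosed_matrices (n : ℕ) : IsClosed (matrices n) := by
  have h1 : ∀ i j, Continuous fun B : Matrix (Fin n) (Fin n) ℝ => B i j :=
    fun i j => continuous_id.matrix_elem i j
  simp only [matrices, Set.ofPred_and, Set.ofPred_forall]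
  exact (isClosed_iInter fun i => isClosed_eq (h1 i i) continuous_const).inter
    (isClosed_iInter fun i => isClosed_iInter fun j =>
      (isClosed_le continuous_const (h1 i j)).inter
        ((isClosed_eq (h1 i j) (h1 j i)).inter (isClosed_le (h1 j i) continuous_const)))

theorem isCompact_simplex_pairs (n : ℕ) : IsCompact
    {p : Matrix (Fin n) (Fin n) ℝ × (Fin n → ℝ) |
      p.1 ∈ matrices n ∧ (∀ i, 0 ≤ p.2 i) ∧ L 1 p.1 p.2 = 1} := by
  have hK : IsCompact ((Set.univ.pi fun _ : Fin n => Set.univ.pi fun _ : Fin n =>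
      Set.Icc (0 : ℝ) 1) ×ˢ (Set.univ.pi fun _ : Fin n => Set.Icc (0 : ℝ) 1)) :=
    (isCompact_univ_pi fun _ => isCompact_univ_pi fun _ => isCompact_Icc).prod
      (isCompact_univ_pi fun _ => isCompact_Icc)
  refine IsCompact.of_isClosed_subset hK ?_ ?_
  · have h2 : ∀ i, Continuous fun p : Matrix (Fin n) (Fin n) ℝ × (Fin n → ℝ) => p.2 i :=
      fun i => (continuous_apply i).comp continuous_snd
    simp only [Set.ofPred_and, Set.ofPred_forall]
    exact ((isClosed_matrices n).preimage continuous_fst).inter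
      ((isClosed_iInter fun i => isClosed_le continuous_const (h2 i)).inter
        (isClosed_eq (continuous_L n 1) continuous_const))
  · rintro ⟨B, y⟩ ⟨hB, hy, h1⟩
    refine ⟨fun i _ j _ => ⟨matrices_nonneg hB i j, matrices_le_one hB i j⟩, fun i _ => ⟨hy i, ?_⟩⟩
    rw [L_one] at h1
    rw [← h1]
    exact single_le_sum (fun j _ => hy j) (mem_univ i)

/-- If `L_r ≥ Φ(L_2)` fails somewhere with `L_2 ∈ [a, b]`, but not with `L_2 ∈ {a, b}`, then it
fails at a pair that satisfies the first-order conditions. -/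
theorem exists_firstOrder {r : ℕ} {Φ μ : ℝ → ℝ} {a b : ℝ} (hΦ : ContinuousOn Φ (Set.Icc a b))
    (hμ : ∀ c ∈ Set.Ioo a b, HasDerivAt Φ (μ c) c)
    (hend : ∀ B ∈ matrices n, ∀ y : Fin n → ℝ, (∀ i, 0 ≤ y i) → L 1 B y = 1 →
      L 2 B y = a ∨ L 2 B y = b → Φ (L 2 B y) ≤ L r B y)
    (hA : A ∈ matrices n) (hx : ∀ i, 0 ≤ x i) (h1 : L 1 A x = 1)
    (h2 : L 2 A x ∈ Set.Icc a b) (hlt : L r A x < Φ (L 2 A x)) :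
    ∃ B ∈ matrices n, ∃ y : Fin n → ℝ, (∀ i, 0 ≤ y i) ∧ L 1 B y = 1 ∧
      L 2 B y ∈ Set.Ioo a b ∧ L r B y < Φ (L 2 B y) ∧ FirstOrder r B y (μ (L 2 B y)) := by
  set K := {p : Matrix (Fin n) (Fin n) ℝ × (Fin n → ℝ) |
      p.1 ∈ matrices n ∧ (∀ i, 0 ≤ p.2 i) ∧ L 1 p.1 p.2 = 1} ∩
      (fun p => L 2 p.1 p.2) ⁻¹' Set.Icc a b with hKdef
  have hK : IsCompact K :=
    (isCompact_simplex_pairs n).inter_right (isClosed_Icc.preimage (continuous_L n 2))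
  have hcont : ContinuousOn (fun p : Matrix (Fin n) (Fin n) ℝ × (Fin n → ℝ) =>
      L r p.1 p.2 - Φ (L 2 p.1 p.2)) K :=
    (continuous_L n r).continuousOn.sub
      (hΦ.comp (continuous_L n 2).continuousOn fun p hp => hp.2)
  obtain ⟨⟨B, y⟩, ⟨⟨hB, hy, hy1⟩, hy2⟩, hmin⟩ :=
    hK.exists_isMinOn ⟨(A, x), ⟨hA, hx, h1⟩, h2⟩ hcont
  have hneg : L r B y < Φ (L 2 B y) := by
    have := hmin (show (A, x) ∈ K from ⟨⟨hA, hx, h1⟩, h2⟩)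
    simp only [Set.mem_ofPred_eq] at this
    linarith
  have hy2 : L 2 B y ∈ Set.Icc a b := hy2
  have hIoo : L 2 B y ∈ Set.Ioo a b := by
    refine ⟨lt_of_le_of_ne hy2.1 fun h => ?_, lt_of_le_of_ne hy2.2 fun h => ?_⟩
    · exact absurd (hend B hB y hy hy1 (Or.inl h.symm)) (not_le.mpr hneg)
    · exact absurd (hend B hB y hy hy1 (Or.inr h)) (not_le.mpr hneg)
  refine ⟨B, hB, y, hy, hy1, hIoo, hneg, fun u v u' v' hu hv hu0 hv0 hpath => ?_⟩
  have hder : HasDerivAt Φ (μ (L 2 B y)) (v 0) := by rw [hv0]; exact hμ _ hIoo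
  refine mul_le_of_right_minimum hu hv hder ?_
  have hev : ∀ᶠ ε in 𝓝[>] (0 : ℝ), v ε ∈ Set.Ioo a b :=
    nhdsWithin_le_nhds (hv.continuousAt.eventually (hv0 ▸ Ioo_mem_nhds hIoo.1 hIoo.2))
  filter_upwards [hev, Ioo_mem_nhdsGT (zero_lt_one' ℝ)] with ε hε hε1
  obtain ⟨C, hC, z, hz, hz1, hzr, hz2⟩ := hpath ε ⟨hε1.1.le, hε1.2.le⟩
  have := hmin (show (C, z) ∈ K from ⟨⟨hC, hz, hz1⟩, by
    show L 2 C z ∈ Set.Icc a b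
    rw [hz2]; exact Set.Ioo_subset_Icc_self hε⟩)
  simp only [Set.mem_ofPred_eq] at this
  rwa [hu0, hv0, ← hzr, ← hz2]

/-! ### Real inequalities -/

/-- Power sums `e_1 = C`, `e_2 = m` in the range that forces `N` parts are attained by a vector
`(τ, …, τ, ζ)` of length `N`. -/
theorem exists_parts {N C m : ℝ} (hN : 1 < N) (hC : 0 ≤ C)
    (h1 : (N - 2) * C ^ 2 ≤ 2 * (N - 1) * m) (h2 : 2 * N * m ≤ (N - 1) * C ^ 2) :
    ∃ τ ζ, 0 ≤ ζ ∧ ζ ≤ τ ∧ C = (N - 1) * τ + ζ ∧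
      m = (N - 1) * (N - 2) / 2 * τ ^ 2 + (N - 1) * τ * ζ := by
  have hN1 : 0 < N - 1 := by linarith
  have hN0 : N ≠ 0 := by linarith
  set q := C ^ 2 - 2 * N / (N - 1) * m with hq
  have hqe : (N - 1) * q = (N - 1) * C ^ 2 - 2 * N * m := by rw [hq]; field_simp
  have hq0 : 0 ≤ q := by nlinarith
  set w := Real.sqrt q with hw
  have hw0 : 0 ≤ w := Real.sqrt_nonneg _
  have hw2 : w ^ 2 = q := Real.sq_sqrt hq0
  have hwC : (N - 1) * w ≤ C := by
    refine abs_le_of_sq_le_sq' ?_ hC |>.2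
    rw [mul_pow, hw2]
    nlinarith
  refine ⟨(C + w) / N, (C - (N - 1) * w) / N, div_nonneg (by linarith) (by linarith), ?_, ?_, ?_⟩
  · exact div_le_div_of_nonneg_right (by nlinarith) (by linarith)
  · field_simp; ring
  · have : m = (N - 1) * (C ^ 2 - w ^ 2) / (2 * N) := by
      rw [hw2]; field_simp; linarith
    rw [this]; field_simp; ring

/-- The tangent plane `(N-1) e_2 - binom(N,2) e_1 + binom(N+1,3)` at vectors `(1, …, 1, y)` of
length `N` bounds `e_3` from below, in the region that the first-order conditions allow for
links. `e_3` is only known to satisfy the Goodman bound and the triangle theorem for `N` parts. -/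
theorem plane_le {N C m e : ℝ} (hN : 3 ≤ N) (hm : 0 ≤ m)
    (hG : m * (4 * m - C ^ 2) ≤ 3 * C * e)
    (hm0 : m ≤ (N - 1) * C - N * (N - 1) / 2) (hm1 : 2 * m ≤ (N - 1) * C) (hC1 : C ≤ N + 1)
    (hT : ∀ τ ζ, 0 ≤ ζ → ζ ≤ τ → C = (N - 1) * τ + ζ →
      m = (N - 1) * (N - 2) / 2 * τ ^ 2 + (N - 1) * τ * ζ →
      (N - 1) * (N - 2) * (N - 3) / 6 * τ ^ 3 + (N - 1) * (N - 2) / 2 * τ ^ 2 * ζ ≤ e) :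
    (N - 1) * m - N * (N - 1) / 2 * C + (N + 1) * N * (N - 1) / 6 ≤ e := by
  have hN1 : 0 < N - 1 := by linarith
  have hC : 0 < C := by
    by_contra h
    nlinarith
  set G : ℝ → ℝ := fun z => z * (4 * z - C ^ 2) -
    3 * C * ((N - 1) * z - N * (N - 1) / 2 * C + (N + 1) * N * (N - 1) / 6) with hGdef
  suffices 0 ≤ G m ∨ (N - 1) * m - N * (N - 1) / 2 * C + (N + 1) * N * (N - 1) / 6 ≤ e by
    rcases this with h | h
    · refine le_of_mul_le_mul_left ?_ (show 0 < 3 * C by linarith)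
      simp only [hGdef] at h
      linarith
    · exact h
  -- `G` is convex, hence decreasing to the left of any point with nonpositive slope.
  have hdec : ∀ z, m ≤ z → 8 * z - C ^ 2 - 3 * C * (N - 1) ≤ 0 → 0 ≤ G z → 0 ≤ G m := by
    intro z hz hs h0
    have : G m = G z + (z - m) * (C ^ 2 + 3 * C * (N - 1) - 4 * (m + z)) := by
      simp only [hGdef]; ring
    rw [this]
    have := mul_nonneg (sub_nonneg.mpr hz)
      (show 0 ≤ C ^ 2 + 3 * C * (N - 1) - 4 * (m + z) by linarith)
    linarith
  rcases le_or_gt C (N - 1) with hc | hc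
  · left
    refine hdec _ hm0 ?_ ?_
    · nlinarith [mul_nonneg hN1.le (sub_nonneg.mpr hc), sq_nonneg (N - 1 - C)]
    · have : G ((N - 1) * C - N * (N - 1) / 2) = (N - 1) * ((C - N) ^ 2 * (N - 1 - C)) := by
        simp only [hGdef]; ring
      rw [this]
      exact mul_nonneg hN1.le (mul_nonneg (sq_nonneg _) (by linarith))
  rcases le_or_gt C N with hc' | hc'
  · rcases le_or_gt (2 * (N - 1) * m) ((N - 2) * C ^ 2) with hk | hk
    · left
      obtain ⟨u, rfl⟩ : ∃ u, C = (N - 1) * u := ⟨C / (N - 1), by field_simp⟩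
      have hu : 1 < u := by
        by_contra h
        nlinarith
      refine hdec ((N - 1) * (N - 2) / 2 * u ^ 2) ?_ ?_ ?_
      · refine le_of_mul_le_mul_left ?_ (show 0 < 2 * (N - 1) by linarith)
        linarith
      · have : 8 * ((N - 1) * (N - 2) / 2 * u ^ 2) - ((N - 1) * u) ^ 2 -
            3 * ((N - 1) * u) * (N - 1) = (N - 1) * u * ((3 * N - 7) * u - 3 * (N - 1)) := by ring
        rw [this]
        refine mul_nonpos_of_nonneg_of_nonpos hC.le ?_
        nlinarith
      · have : G ((N - 1) * (N - 2) / 2 * u ^ 2) = 3 * ((N - 1) * u) * ((N - 1) / 6 * ((u - 1) *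
            ((N - 2) * (N - 3) * u ^ 2 - 2 * N * (N - 2) * u + N * (N + 1)))) := by
          simp only [hGdef]; ring
        rw [this]
        refine mul_nonneg (by linarith) (mul_nonneg (by linarith) (mul_nonneg (by linarith) ?_))
        have h3 : 0 ≤ (N - 2) * (N - 3) * (u - 1) ^ 2 :=
          mul_nonneg (mul_nonneg (by linarith) (by linarith)) (sq_nonneg _)
        nlinarith
    · right
      obtain ⟨τ, ζ, hζ, hζτ, hCe, hme⟩ := exists_parts (by linarith) hC.le hk.le (by
        nlinarith [mul_nonneg hN1.le (sq_nonneg (C - N))] : 2 * N * m ≤ (N - 1) * C ^ 2)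
      refine le_trans ?_ (hT τ ζ hζ hζτ hCe hme)
      have hCτ : C ≤ N * τ := by linarith
      have hτC : (N - 1) * τ ≤ C := by linarith
      have hζe : ζ = C - (N - 1) * τ := by linarith
      have hτ : 1 ≤ τ := by
        by_contra h
        push Not at h
        have h1 : (N - 1) * C - N * (N - 1) / 2 - m = (N - 1) * ((τ - 1) * (N * (τ + 1) / 2 - C)) := by
          rw [hme, hζe]; ring
        have h2 : 0 < N * (τ + 1) / 2 - C := by nlinarith
        have h3 : 0 < (N - 1) * ((1 - τ) * (N * (τ + 1) / 2 - C)) :=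
          mul_pos hN1 (mul_pos (by linarith) h2)
        linarith
      have hid : (N - 1) * (N - 2) * (N - 3) / 6 * τ ^ 3 + (N - 1) * (N - 2) / 2 * τ ^ 2 * ζ -
          ((N - 1) * m - N * (N - 1) / 2 * C + (N + 1) * N * (N - 1) / 6) =
          (N - 1) * ((τ - 1) * ((N - C) * ((N - 1) - (N - 2) * (τ + 1) / 2) +
            N / 6 * ((τ - 1) * (3 * (N - 1) - (N - 2) * (2 * τ + 1))))) := by
        rw [hme, hζe]; ring
      have hτN : (N - 1) * τ ≤ N := by linarith
      have h1 : 0 ≤ (N - 1) - (N - 2) * (τ + 1) / 2 := by nlinarith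
      have h2 : 0 ≤ 3 * (N - 1) - (N - 2) * (2 * τ + 1) := by nlinarith
      have h3 : 0 ≤ τ - 1 := by linarith
      have h4 : 0 ≤ N - C := by linarith
      have : 0 ≤ (N - 1) * ((τ - 1) * ((N - C) * ((N - 1) - (N - 2) * (τ + 1) / 2) +
            N / 6 * ((τ - 1) * (3 * (N - 1) - (N - 2) * (2 * τ + 1))))) := by positivity
      linarith
  · left
    refine hdec ((N - 1) * C / 2) (by linarith) ?_ ?_
    · nlinarith
    · have : G ((N - 1) * C / 2) = 3 * C * ((N - 1) / 6 * ((C - N) * (N + 1 - C))) := by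
        simp only [hGdef]; ring
      rw [this]
      have h4 : 0 ≤ C - N := by linarith
      have h5 : 0 ≤ N + 1 - C := by linarith
      positivity

/-- The companion of `plane_le` for four-cliques: the first-order conditions put the pair
`(e_1, e_2)` of a link strictly below the line `e_2 = (N-1) e_1 - binom(N,2)`. -/
theorem lt_line {N C m e : ℝ} (hN : 3 ≤ N) (he0 : 0 ≤ e)
    (hG : m * (4 * m - C ^ 2) ≤ 3 * C * e)
    (he : e < (N - 1) * (N - 2) / 2 * C - N * (N - 1) * (N - 2) / 3)
    (he1 : 3 * e ≤ (N - 1) * (N - 2) / 2 * C) (hC1 : C ≤ N + 1)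
    (hT : ∀ τ ζ, 0 ≤ ζ → ζ ≤ τ → C = (N - 1) * τ + ζ →
      m = (N - 1) * (N - 2) / 2 * τ ^ 2 + (N - 1) * τ * ζ →
      (N - 1) * (N - 2) * (N - 3) / 6 * τ ^ 3 + (N - 1) * (N - 2) / 2 * τ ^ 2 * ζ ≤ e) :
    m < (N - 1) * C - N * (N - 1) / 2 := by
  have hN1 : 0 < N - 1 := by linarith
  have hN2 : 0 < N - 2 := by linarith
  have hN12 : 0 < (N - 1) * (N - 2) := mul_pos hN1 hN2
  have hC23 : 2 * N / 3 < C := by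
    by_contra h
    push Not at h
    nlinarith
  have hC : 0 < C := by linarith
  by_contra hm
  push Not at hm
  set m0 := (N - 1) * C - N * (N - 1) / 2 with hm0def
  have h8 : C ^ 2 ≤ 8 * m0 := by
    nlinarith [mul_nonneg (sub_nonneg.mpr hC23.le)
      (show 0 ≤ 8 * (N - 1) - C - 2 * N / 3 by linarith)]
  -- the Goodman bound increases with `m ≥ C²/8`
  have hmono : ∀ z, C ^ 2 ≤ 8 * z → z ≤ m → z * (4 * z - C ^ 2) ≤ 3 * C * e := by
    intro z hz hzm
    nlinarith [mul_nonneg (sub_nonneg.mpr hzm) (show 0 ≤ 4 * (m + z) - C ^ 2 by linarith)]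
  rcases le_or_gt C (N - 1) with hc | hc
  · have h1 := hmono m0 h8 hm
    have h2 : m0 * (4 * m0 - C ^ 2) = 3 * C * ((N - 1) * (N - 2) / 2 * C -
        N * (N - 1) * (N - 2) / 3) + (N - 1) * ((C - N) ^ 2 * (N - 1 - C)) := by
      rw [hm0def]; ring
    have h3 : 0 ≤ (N - 1) * ((C - N) ^ 2 * (N - 1 - C)) :=
      mul_nonneg hN1.le (mul_nonneg (sq_nonneg _) (by linarith))
    have h4 := mul_lt_mul_of_pos_left he (show 0 < 3 * C by linarith)
    linarith
  rcases le_or_gt C N with hc' | hc'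
  · rcases le_or_gt (2 * N * m) ((N - 1) * C ^ 2) with hk | hk
    · have hlow : (N - 2) * C ^ 2 ≤ 2 * (N - 1) * m := by
        have h1 : 2 * (N - 1) * m0 - (N - 2) * C ^ 2 =
          (C - (N - 1)) * (N * (N - 1) - (N - 2) * C) := by rw [hm0def]; ring
        have h2 : 0 ≤ (C - (N - 1)) * (N * (N - 1) - (N - 2) * C) :=
          mul_nonneg (by linarith) (by nlinarith)
        have h3 := mul_le_mul_of_nonneg_left hm (show 0 ≤ 2 * (N - 1) by linarith)
        linarith
      obtain ⟨τ, ζ, hζ, hζτ, hCe, hme⟩ := exists_parts (by linarith) hC.le hlow hk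
      have hT' := hT τ ζ hζ hζτ hCe hme
      have hCτ : C ≤ N * τ := by linarith
      have hζe : ζ = C - (N - 1) * τ := by linarith
      have hτ0 : 0 ≤ τ := by linarith
      have hτ : τ ≤ 1 := by
        by_contra h
        push Not at h
        have h1 : m0 - m = (N - 1) * ((τ - 1) * (N * (τ + 1) / 2 - C)) := by
          rw [hm0def, hme, hζe]; ring
        have h2 : 0 < N * (τ + 1) / 2 - C := by nlinarith
        have h3 : 0 < (N - 1) * ((τ - 1) * (N * (τ + 1) / 2 - C)) :=
          mul_pos hN1 (mul_pos (by linarith) h2)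
        linarith
      have hid : (N - 1) * (N - 2) * (N - 3) / 6 * τ ^ 3 + (N - 1) * (N - 2) / 2 * τ ^ 2 * ζ -
          ((N - 1) * (N - 2) / 2 * C - N * (N - 1) * (N - 2) / 3) =
          (N - 1) * (N - 2) * ((1 - τ) * ((N * τ - C) * (1 + τ) / 2 +
            N / 6 * ((1 - τ) * (2 + τ)))) := by
        rw [hζe]; ring
      have h3 : 0 ≤ 1 - τ := by linarith
      have h4 : 0 ≤ N * τ - C := by linarith
      have : 0 ≤ (N - 1) * (N - 2) * ((1 - τ) * ((N * τ - C) * (1 + τ) / 2 +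
            N / 6 * ((1 - τ) * (2 + τ)))) := by positivity
      linarith
    · obtain ⟨v, rfl⟩ : ∃ v, C = N * v := ⟨C / N, by field_simp⟩
      have hv : 0 < v := by
        by_contra h
        nlinarith
      have h1 := hmono ((N - 1) * N / 2 * v ^ 2) (by nlinarith [sq_nonneg v, mul_pos hN1 hv]) (by
        refine le_of_mul_le_mul_left ?_ (show 0 < 2 * N by linarith)
        linarith)
      have h2 : (N - 1) * N / 2 * v ^ 2 * (4 * ((N - 1) * N / 2 * v ^ 2) - (N * v) ^ 2) =
          3 * (N * v) * ((N - 1) * (N - 2) / 2 * (N * v) - N * (N - 1) * (N - 2) / 3) +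
          3 * (N * v) * ((N - 1) * (N - 2) * N / 6 * ((v - 1) ^ 2 * (v + 2))) := by ring
      have h3 : 0 ≤ 3 * (N * v) * ((N - 1) * (N - 2) * N / 6 * ((v - 1) ^ 2 * (v + 2))) := by
        positivity
      have h4 := mul_lt_mul_of_pos_left he (show 0 < 3 * (N * v) by linarith)
      linarith
  · have h1 := hmono m0 h8 hm
    have h2 : m0 * (4 * m0 - C ^ 2) = C * ((N - 1) * (N - 2) / 2 * C) +
        (N - 1) * ((C - N) * (3 * (N - 1) * C - C ^ 2 - N * (N - 1))) := by
      rw [hm0def]; ring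
    have h3 : 0 < (N - 1) * ((C - N) * (3 * (N - 1) * C - C ^ 2 - N * (N - 1))) :=
      mul_pos hN1 (mul_pos (by linarith)
        (by nlinarith [mul_nonneg (sub_nonneg.mpr hc'.le) (sub_nonneg.mpr hC1)]))
    have h4 := mul_le_mul_of_nonneg_left he1 hC.le
    linarith

/-! ### Upper and lower bounds for `L_4` at a minimiser -/

/-- The triangle theorem for `s` parts, in homogeneous form: if `L_1` and `L_2` are the elementary
symmetric functions of a vector `(t, …, t, z)` of length `s` with `0 ≤ z ≤ t`, then `L_3` is at
least the third one. -/
def TriangleBound (s : ℕ) : Prop :=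
  ∀ (n : ℕ) (A : Matrix (Fin n) (Fin n) ℝ) (x : Fin n → ℝ), A ∈ matrices n → (∀ i, 0 ≤ x i) →
    ∀ t z : ℝ, 0 ≤ z → z ≤ t → L 1 A x = (s - 1) * t + z →
      L 2 A x = (s - 1) * (s - 2) / 2 * t ^ 2 + (s - 1) * t * z →
      (s - 1) * (s - 2) * (s - 3) / 6 * t ^ 3 + (s - 1) * (s - 2) / 2 * t ^ 2 * z ≤ L 3 A x

/-- The third elementary symmetric function of `(t, …, t, 1 - (S-1) t)`, of length `S`. -/
noncomputable def partsThree (S t : ℝ) : ℝ :=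
  (S - 1) * (S - 2) * (S - 3) / 6 * t ^ 3 + (S - 1) * (S - 2) / 2 * t ^ 2 * (1 - (S - 1) * t)

/-- The fourth elementary symmetric function of `(t, …, t, 1 - (S-1) t)`, of length `S`. -/
noncomputable def partsFour (S t : ℝ) : ℝ :=
  (S - 1) * (S - 2) * (S - 3) * (S - 4) / 24 * t ^ 4 +
    (S - 1) * (S - 2) * (S - 3) / 6 * t ^ 3 * (1 - (S - 1) * t)

/-- The first-order conditions with multiplier `(s-2) t` bound the number of triangles in the
link of each vertex from below by a linear function of its edges and its total weight. -/
theorem FirstOrder.plane_le_link {s : ℕ} (hs : 4 ≤ s) (hT : TriangleBound (s - 1)) {t : ℝ}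
    (ht : 1 < s * t) (hA : A ∈ matrices n) (hx : ∀ i, 0 ≤ x i) (h1 : L 1 A x = 1)
    (h2 : L 2 A x = (s - 1) * t - s * (s - 1) / 2 * t ^ 2) (h3 : L 3 A x < partsThree s t)
    (hF : FirstOrder 3 A x ((s - 2) * t)) {i : Fin n} (hi : 0 < x i) :
    (s - 2) * t * L 2 A (link A i x) - (s - 1) * (s - 2) / 2 * t ^ 2 * deg A x i +
      s * (s - 1) * (s - 2) / 6 * t ^ 3 ≤ L 3 A (link A i x) := by
  have hS : (4 : ℝ) ≤ s := by exact_mod_cast hs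
  have ht0 : 0 < t := by
    by_contra h
    push Not at h
    nlinarith
  set y : Fin n → ℝ := fun j => t⁻¹ * link A i x j with hy
  have hy0 : ∀ j, 0 ≤ y j := fun j => mul_nonneg (inv_nonneg.mpr ht0.le) (link_nonneg hA hx i j)
  have e1 : deg A x i = t * L 1 A y := by
    rw [hy, L_smul, L_one_link]; field_simp
  have e2 : L 2 A (link A i x) = t ^ 2 * L 2 A y := by
    rw [hy, L_smul]; field_simp
  have e3 : L 3 A (link A i x) = t ^ 3 * L 3 A y := by
    rw [hy, L_smul]; field_simp
  have k1 := hF.link_eq (r := 2) hA hx h1 hi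
  have k2 := hF.link_le (r := 2) hA hx h1 hi
  have k3 : deg A x i ≤ 1 := h1 ▸ deg_le hA hx i
  push_cast at k1 k2
  rw [e1, e2] at k1 k2
  rw [e1] at k3
  have key := plane_le (N := (s : ℝ) - 1) (C := L 1 A y) (m := L 2 A y) (e := L 3 A y)
    (by linarith) (L_nonneg hA hy0 2) (by linarith [goodman hA hy0]) ?_ ?_ ?_ ?_
  · rw [e1, e2, e3]
    have := mul_le_mul_of_nonneg_left key (pow_nonneg ht0.le 3)
    linarith
  · refine le_of_mul_le_mul_left ?_ (pow_pos ht0 2)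
    rw [k1, h2]
    unfold partsThree at h3
    linarith
  · refine le_of_mul_le_mul_left ?_ (pow_pos ht0 2)
    linarith
  · refine le_of_mul_le_mul_left ?_ ht0
    linarith
  · intro τ ζ hζ hζτ hC hm
    have := hT n A y hA hy0 τ ζ hζ hζτ
    rw [Nat.cast_sub (by omega : 1 ≤ s), Nat.cast_one] at this
    exact this hC hm

/-- The first-order conditions bound `L_4` from above by lower forms; the terms quadratic in the
degrees cancel. -/
theorem FirstOrder.four_mul_L_four_le {μ : ℝ} (hF : FirstOrder 3 A x μ) (hA : A ∈ matrices n)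
    (hx : ∀ i, 0 ≤ x i) (h1 : L 1 A x = 1) :
    4 * L 4 A x ≤ μ * L 2 A x + 3 * μ * L 3 A x - 2 * L 3 A x +
      2 * (3 * L 3 A x - 2 * μ * L 2 A x) * L 2 A x := by
  have hE := hF.sum_edges_mul_le hA hx h1
  have hQ := four_L_four_le hA hx
  rw [h1] at hQ
  have s1 : ∑ i, ∑ j, A i j * (x i * x j) * codeg A x i j *
      (1 - deg A x i - deg A x j + codeg A x i j) = 6 * L 3 A x -
      4 * ∑ i, x i * (deg A x i * L 2 A (link A i x)) + codegSq A x := by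
    rw [← sum_edges_codeg hA, ← sum_edges_codeg_deg hA, codegSq]
    simp_rw [← sum_sub_distrib, ← sum_add_distrib]
    exact sum_congr rfl fun i _ => sum_congr rfl fun j _ => by ring
  have s2 : ∑ i, ∑ j, A i j * (x i * x j) * (1 - deg A x i - deg A x j + codeg A x i j) =
      2 * L 2 A x - 2 * ∑ i, x i * deg A x i ^ 2 + 6 * L 3 A x := by
    rw [← sum_edges_codeg hA, ← sum_edges_deg hA, ← sum_edges hA]
    simp_rw [← sum_sub_distrib, ← sum_add_distrib]
    exact sum_congr rfl fun i _ => sum_congr rfl fun j _ => by ring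
  have s3 : ∑ i, x i * (deg A x i * L 2 A (link A i x)) =
      μ * ∑ i, x i * deg A x i ^ 2 + (3 * L 3 A x - 2 * μ * L 2 A x) * (2 * L 2 A x) := by
    rw [← sum_mul_deg hA, mul_sum, mul_sum, ← sum_add_distrib]
    refine sum_congr rfl fun i _ => ?_
    rcases (hx i).eq_or_lt with h | h
    · rw [← h]; ring
    · have := hF.link_eq (r := 2) hA hx h1 h
      push_cast at this
      rw [this]; ring
  rw [s1, s2] at hE
  rw [s3] at hE hQ
  linarith

/-- A minimiser below the claimed value would give incompatible upper and lower bounds for `L_4`.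
For `s = 3` the lower bound is just `L_4 ≥ 0`. -/
theorem not_firstOrder_three {s : ℕ} (hs : 3 ≤ s) (hT : TriangleBound (s - 1)) {t : ℝ}
    (ht : 1 < s * t) (hA : A ∈ matrices n) (hx : ∀ i, 0 ≤ x i) (h1 : L 1 A x = 1)
    (hc : (s - 2) / (2 * (s - 1)) < L 2 A x)
    (h2 : L 2 A x = (s - 1) * t - s * (s - 1) / 2 * t ^ 2) (h3 : L 3 A x < partsThree s t) :
    ¬ FirstOrder 3 A x ((s - 2) * t) := by
  intro hF
  have hup := hF.four_mul_L_four_le hA hx h1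
  rcases hs.eq_or_lt with rfl | hs4
  · have h4 := L_nonneg hA hx 4
    unfold partsThree at h3
    norm_num at *
    have hpos : 0 < 3 * t - 2 + 6 * L 2 A x := by linarith
    have h5 := mul_pos (sub_pos.mpr h3) hpos
    rw [h2] at h5 hup
    nlinarith
  · have hS : (4 : ℝ) ≤ s := by exact_mod_cast hs4
    have hc3 : 1 / 3 < L 2 A x := by
      refine lt_of_le_of_lt ?_ hc
      rw [div_le_div_iff₀ (by norm_num) (by linarith)]
      linarith
    have hlow : (s - 2) * t * (3 * L 3 A x) - (s - 1) * (s - 2) / 2 * t ^ 2 * (2 * L 2 A x) +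
        s * (s - 1) * (s - 2) / 6 * t ^ 3 * L 1 A x ≤ 4 * L 4 A x := by
      rw [← sum_mul_L_two_link hA, ← sum_mul_deg hA, L_one, ← sum_mul_L_three_link hA,
        mul_sum, mul_sum, mul_sum, ← sum_sub_distrib, ← sum_add_distrib]
      refine sum_le_sum fun i _ => ?_
      rcases (hx i).eq_or_lt with h | h
      · rw [← h]; simp
      · have := mul_le_mul_of_nonneg_left (hF.plane_le_link hs4 hT ht hA hx h1 h2 h3 h) h.le
        linarith
    have h5 := mul_pos (sub_pos.mpr h3) (sub_pos.mpr hc3)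
    unfold partsThree at h5
    rw [h1] at hlow
    rw [h2] at hup hlow h5
    nlinarith

/-! ### The extremal functions of `c` -/

theorem one_sub_eq_sq {S t : ℝ} (hS : 1 < S) {c : ℝ} (hc : c = (S - 1) * t - S * (S - 1) / 2 * t ^ 2) :
    1 - 2 * S / (S - 1) * c = (S * t - 1) ^ 2 := by
  have : S - 1 ≠ 0 := by linarith
  rw [hc]; field_simp; ring

/-- `weightX s c` is the larger root `t` of `c = (s-1) t - binom(s,2) t²`. -/
theorem weightX_eq {s : ℕ} (hs : 2 ≤ s) {t c : ℝ} (ht : 1 ≤ s * t)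
    (hc : c = (s - 1) * t - s * (s - 1) / 2 * t ^ 2) : weightX s c = t := by
  have hS : (2 : ℝ) ≤ s := by exact_mod_cast hs
  rw [weightX, one_sub_eq_sq (by linarith) hc, Real.sqrt_sq (by linarith)]
  field_simp; ring

theorem mul_weightX {s : ℕ} (hs : 2 ≤ s) (c : ℝ) :
    s * weightX s c = 1 + Real.sqrt (1 - 2 * s / (s - 1) * c) := by
  have hS : (2 : ℝ) ≤ s := by exact_mod_cast hs
  rw [weightX]; field_simp

theorem weightX_spec {s : ℕ} (hs : 2 ≤ s) {c : ℝ} (hc : c ≤ (s - 1) / (2 * s)) :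
    c = (s - 1) * weightX s c - s * (s - 1) / 2 * weightX s c ^ 2 := by
  have hS : (2 : ℝ) ≤ s := by exact_mod_cast hs
  have hS1 : (s : ℝ) - 1 ≠ 0 := by linarith
  have hw : 0 ≤ 1 - 2 * (s : ℝ) / (s - 1) * c := by
    rw [le_div_iff₀ (by linarith)] at hc
    rw [sub_nonneg, div_mul_eq_mul_div, div_le_one (by linarith)]
    linarith
  have h2 := Real.sq_sqrt hw
  have h := mul_weightX hs c
  have h3 : Real.sqrt (1 - 2 * s / (s - 1) * c) = s * weightX s c - 1 := by linarith
  rw [h3] at h2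
  field_simp at h2
  nlinarith

theorem weightX_upper {s : ℕ} (hs : 2 ≤ s) : weightX s ((s - 1) / (2 * s)) = 1 / s := by
  have hS : (2 : ℝ) ≤ s := by exact_mod_cast hs
  refine weightX_eq hs (by field_simp; norm_num) ?_
  field_simp; ring

theorem weightX_lower {s : ℕ} (hs : 2 ≤ s) :
    weightX s ((s - 2) / (2 * (s - 1))) = 1 / (s - 1) := by
  have hS : (2 : ℝ) ≤ s := by exact_mod_cast hs
  have hS1 : 0 < (s : ℝ) - 1 := by linarith
  refine weightX_eq hs ?_ ?_
  · rw [mul_one_div, le_div_iff₀ hS1]; linarith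
  · field_simp; ring

theorem hasDerivAt_weightX {s : ℕ} (hs : 2 ≤ s) {c : ℝ} (hc : c < (s - 1) / (2 * s)) :
    HasDerivAt (weightX s) (-1 / ((s - 1) * (s * weightX s c - 1))) c ∧ 1 < s * weightX s c := by
  have hS : (2 : ℝ) ≤ s := by exact_mod_cast hs
  have hS1 : 0 < (s : ℝ) - 1 := by linarith
  have hw : 0 < 1 - 2 * (s : ℝ) / (s - 1) * c := by
    rw [lt_div_iff₀ (by linarith)] at hc
    rw [sub_pos, div_mul_eq_mul_div, div_lt_one hS1]
    linarith
  have hsq := Real.sqrt_pos.mpr hw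
  have h := mul_weightX hs c
  refine ⟨?_, by linarith⟩
  have hd := ((((((hasDerivAt_id' c).const_mul (2 * (s : ℝ) / (s - 1))).const_sub 1).sqrt
    hw.ne').const_mul (1 / (s : ℝ))).const_add (1 / (s : ℝ)))
  refine HasDerivAt.congr_deriv hd ?_
  have h3 : s * weightX s c - 1 = Real.sqrt (1 - 2 * s / (s - 1) * c) := by linarith
  rw [h3]
  have := hsq.ne'
  field_simp

theorem continuous_weightX (s : ℕ) : Continuous (weightX s) := by
  unfold weightX
  fun_prop

/-- The derivative of the claimed minimum of `L_3` in the edge density is the multiplier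
`(s - 2) x` of the first-order conditions. -/
theorem hasDerivAt_partsThree {s : ℕ} (hs : 2 ≤ s) {c : ℝ} (hc : c < (s - 1) / (2 * s)) :
    HasDerivAt (fun c => partsThree s (weightX s c)) ((s - 2) * weightX s c) c := by
  obtain ⟨hd, h1⟩ := hasDerivAt_weightX hs hc
  have hS : (2 : ℝ) ≤ s := by exact_mod_cast hs
  have hS1 : (s : ℝ) - 1 ≠ 0 := by linarith
  have hw : (s : ℝ) * weightX s c - 1 ≠ 0 := by linarith
  have := ((hd.fun_pow 3).const_mul (((s : ℝ) - 1) * (s - 2) * (s - 3) / 6)).fun_add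
    (((hd.fun_pow 2).const_mul (((s : ℝ) - 1) * (s - 2) / 2)).fun_mul
      ((hd.const_mul ((s : ℝ) - 1)).const_sub 1))
  refine HasDerivAt.congr_deriv this ?_
  push_cast
  field_simp
  ring

theorem hasDerivAt_partsFour {s : ℕ} (hs : 2 ≤ s) {c : ℝ} (hc : c < (s - 1) / (2 * s)) :
    HasDerivAt (fun c => partsFour s (weightX s c))
      ((s - 2) * (s - 3) / 2 * weightX s c ^ 2) c := by
  obtain ⟨hd, h1⟩ := hasDerivAt_weightX hs hc
  have hS : (2 : ℝ) ≤ s := by exact_mod_cast hs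
  have hS1 : (s : ℝ) - 1 ≠ 0 := by linarith
  have hw : (s : ℝ) * weightX s c - 1 ≠ 0 := by linarith
  have := ((hd.fun_pow 4).const_mul (((s : ℝ) - 1) * (s - 2) * (s - 3) * (s - 4) / 24)).fun_add
    (((hd.fun_pow 3).const_mul (((s : ℝ) - 1) * (s - 2) * (s - 3) / 6)).fun_mul
      ((hd.const_mul ((s : ℝ) - 1)).const_sub 1))
  refine HasDerivAt.congr_deriv this ?_
  push_cast
  field_simp
  ring

/-! ### Turán densities -/

theorem le_L_three_of_turan (hA : A ∈ matrices n) (hx : ∀ i, 0 ≤ x i) (h1 : L 1 A x = 1) {R : ℝ}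
    (hR : 1 ≤ R) (h2 : L 2 A x = (R - 1) / (2 * R)) :
    (R - 1) * (R - 2) / (6 * R ^ 2) ≤ L 3 A x := by
  have := goodman hA hx
  rw [h1, h2] at this
  have e : (R - 1) / (2 * R) * (4 * ((R - 1) / (2 * R)) - 1 ^ 2) =
    3 * ((R - 1) * (R - 2) / (6 * R ^ 2)) := by field_simp; ring
  rw [e] at this
  linarith

theorem le_L_four_of_turan (hA : A ∈ matrices n) (hx : ∀ i, 0 ≤ x i) (h1 : L 1 A x = 1) {R : ℝ}
    (hR : 3 ≤ R) (h2 : L 2 A x = (R - 1) / (2 * R)) :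
    (R - 1) * (R - 2) * (R - 3) / (24 * R ^ 3) ≤ L 4 A x := by
  have h3 := le_L_three_of_turan hA hx h1 (by linarith) h2
  have hQ := three_codegSq_le hA hx
  have hC := sq_L_three_le hA hx
  rw [h1] at hQ
  rw [h2] at hC
  set a := (R - 1) * (R - 2) / (6 * R ^ 2) with ha
  have hR0 : 0 < R := by linarith
  have hR1 : 0 < R - 1 := by linarith
  have ha0 : 0 ≤ a := by
    rw [ha]
    have : 0 ≤ R - 2 := by linarith
    positivity
  have e : (R - 1) * (R - 2) * (R - 3) / (24 * R ^ 3) = a * (R - 3) / (4 * R) := by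
    rw [ha]; field_simp; ring
  have hC' : 36 * R * L 3 A x ^ 2 ≤ (R - 1) * codegSq A x := by
    have : 2 * ((R - 1) / (2 * R)) * codegSq A x = (R - 1) * codegSq A x / R := by field_simp
    rw [this, le_div_iff₀ hR0] at hC
    linarith
  have haR : 6 * R ^ 2 * a = (R - 1) * (R - 2) := by rw [ha]; field_simp
  rw [e, div_le_iff₀ (by linarith)]
  -- `L_4 ≥ L_3 (9 L_3 / L_2 - 1) / 8`, which increases with `L_3 ≥ a`
  have h4 : 108 * R * L 3 A x ^ 2 ≤ (R - 1) * (6 * L 3 A x + 48 * L 4 A x) := by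
    nlinarith [mul_le_mul_of_nonneg_left hQ hR1.le]
  have h5 : 108 * R * a ^ 2 - 6 * (R - 1) * a ≤
      108 * R * L 3 A x ^ 2 - 6 * (R - 1) * L 3 A x := by
    have : 0 ≤ 108 * R * (L 3 A x + a) - 6 * (R - 1) := by
      have h6 : 216 * R * a ≤ 108 * R * (L 3 A x + a) := by nlinarith
      have h7 : 6 * (R - 1) ≤ 216 * R * a := by
        refine le_of_mul_le_mul_left ?_ hR0
        nlinarith
      linarith
    nlinarith [mul_nonneg (sub_nonneg.mpr h3) this]
  have h8 : 108 * R ^ 2 * a ^ 2 - 6 * R * (R - 1) * a = 12 * (R - 1) * (a * (R - 3)) := by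
    linear_combination 18 * a * haR
  have h9 : 12 * (R - 1) * (a * (R - 3)) ≤ 12 * (R - 1) * (L 4 A x * (4 * R)) := by
    have h10 : 108 * R * a ^ 2 - 6 * (R - 1) * a ≤ 48 * (R - 1) * L 4 A x := by linarith
    have h11 := mul_le_mul_of_nonneg_left h10 hR0.le
    linarith
  exact le_of_mul_le_mul_left h9 (by linarith)

/-! ### Triangles -/

/-- At the ends of the interval the densities are Turán densities. Inside it, a violation would
produce a minimiser of `L_3` minus the claimed value, which `not_firstOrder_three` excludes. -/
theorem partsThree_le {s : ℕ} (hs : 3 ≤ s) (hT : TriangleBound (s - 1)) (hA : A ∈ matrices n)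
    (hx : ∀ i, 0 ≤ x i) (h1 : L 1 A x = 1)
    (h2 : L 2 A x ∈ Set.Icc (((s : ℝ) - 2) / (2 * (s - 1))) ((s - 1) / (2 * s))) :
    partsThree s (weightX s (L 2 A x)) ≤ L 3 A x := by
  have hS : (3 : ℝ) ≤ s := by exact_mod_cast hs
  have hS1 : (s : ℝ) - 1 ≠ 0 := by linarith
  by_contra h
  push Not at h
  have hcont : Continuous fun c => partsThree s (weightX s c) := by
    have := continuous_weightX s
    unfold partsThree
    fun_prop
  have hend : ∀ B ∈ matrices n, ∀ y : Fin n → ℝ, (∀ i, 0 ≤ y i) → L 1 B y = 1 →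
      L 2 B y = ((s : ℝ) - 2) / (2 * (s - 1)) ∨ L 2 B y = ((s : ℝ) - 1) / (2 * s) →
      partsThree s (weightX s (L 2 B y)) ≤ L 3 B y := by
    rintro B hB y hy hy1 (hy2 | hy2)
    · have h3 := le_L_three_of_turan hB hy hy1 (R := (s : ℝ) - 1) (by linarith)
        (by rw [hy2]; ring)
      refine le_trans (le_of_eq ?_) h3
      rw [hy2, weightX_lower (by omega), partsThree]
      field_simp; ring
    · have h3 := le_L_three_of_turan hB hy hy1 (R := s) (by linarith) hy2
      refine le_trans (le_of_eq ?_) h3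
      rw [hy2, weightX_upper (by omega), partsThree]
      field_simp; ring
  obtain ⟨B, hB, y, hy, hy1, hy2, hy3, hF⟩ := exists_firstOrder (r := 3)
    (Φ := fun c => partsThree s (weightX s c)) (μ := fun c => (s - 2) * weightX s c)
    hcont.continuousOn (fun c hc => hasDerivAt_partsThree (by omega) hc.2) hend hA hx h1 h2 h
  exact not_firstOrder_three hs hT (hasDerivAt_weightX (by omega) hy2.2).2 hB hy hy1 hy2.1
    (weightX_spec (by omega) hy2.2.le) hy3 hF

theorem triangleBound {s : ℕ} (hs : 2 ≤ s) : TriangleBound s := by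
  induction s, hs using Nat.le_induction with
  | base =>
    intro n A x hA hx t z _ _ _ _
    have := L_nonneg hA hx 3
    norm_num
    exact this
  | succ s hs ih =>
    intro n A x hA hx t z hz hzt h1 h2
    have hS : (2 : ℝ) ≤ s := by exact_mod_cast hs
    push_cast at h1 h2 ⊢
    have ht : 0 ≤ t := hz.trans hzt
    rcases ht.eq_or_lt with rfl | ht
    · have := L_nonneg hA hx 3
      simpa using this
    set T := (s : ℝ) * t + z with hTdef
    have hTpos : 0 < T := by
      have : 0 < (s : ℝ) * t := mul_pos (by linarith) ht
      linarith
    set y : Fin n → ℝ := fun i => T⁻¹ * x i with hy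
    have hy0 : ∀ i, 0 ≤ y i := fun i => mul_nonneg (inv_nonneg.mpr hTpos.le) (hx i)
    have hs1 : (s : ℝ) + 1 - 1 = s := by ring
    have e1 : L 1 A y = 1 := by
      rw [hy, L_smul, h1, hs1, ← hTdef, pow_one, inv_mul_cancel₀ hTpos.ne']
    have e2 : L 2 A y = (((s + 1 : ℕ) : ℝ) - 1) * (t / T) -
        ((s + 1 : ℕ) : ℝ) * (((s + 1 : ℕ) : ℝ) - 1) / 2 * (t / T) ^ 2 := by
      rw [hy, L_smul, h2]
      have hzT : z = T - s * t := by rw [hTdef]; ring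
      push_cast
      rw [hzT]
      field_simp; ring
    have hw : weightX (s + 1) (L 2 A y) = t / T := by
      refine weightX_eq (by omega) ?_ e2
      push_cast
      rw [mul_div_assoc', one_le_div hTpos, hTdef]
      linarith
    have hle : s * (t / T) ≤ 1 := by
      rw [mul_div_assoc', div_le_one hTpos, hTdef]; linarith
    have hge : 1 ≤ (s + 1) * (t / T) := by
      rw [mul_div_assoc', one_le_div hTpos, hTdef]; linarith
    have key := partsThree_le (s := s + 1) (by omega) ih hA hy0 e1 ?_
    · rw [hw, partsThree, hy, L_smul] at key
      push_cast at key
      have hk := mul_le_mul_of_nonneg_left key (pow_nonneg hTpos.le 3)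
      have hzT : z = T - s * t := by rw [hTdef]; ring
      rw [hzT]
      refine le_of_eq_of_le ?_ (hk.trans_eq ?_)
      · field_simp; ring
      · field_simp
    · rw [e2]
      push_cast
      constructor
      · rw [div_le_iff₀ (by linarith)]
        nlinarith [mul_nonneg (sub_nonneg.mpr hle) (sub_nonneg.mpr hge)]
      · rw [le_div_iff₀ (by linarith)]
        nlinarith [sq_nonneg ((s + 1) * (t / T) - 1)]

/-! ### Four-cliques -/

/-- At a minimiser for `L_4`, the triangle theorem in the links bounds `L_3` from above, in
contradiction to the triangle theorem for the whole. -/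
theorem not_firstOrder_four {s : ℕ} (hs : 4 ≤ s) {t : ℝ} (ht : 1 < s * t) (hA : A ∈ matrices n)
    (hx : ∀ i, 0 ≤ x i) (h1 : L 1 A x = 1)
    (h2 : L 2 A x = (s - 1) * t - s * (s - 1) / 2 * t ^ 2) (h3 : partsThree s t ≤ L 3 A x)
    (h4 : L 4 A x < partsFour s t) :
    ¬ FirstOrder 4 A x ((s - 2) * (s - 3) / 2 * t ^ 2) := by
  intro hF
  have hS : (4 : ℝ) ≤ s := by exact_mod_cast hs
  have ht0 : 0 < t := by
    by_contra h
    push Not at h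
    nlinarith
  have key : ∀ i, 0 < x i →
      L 2 A (link A i x) < (s - 2) * t * deg A x i - (s - 1) * (s - 2) / 2 * t ^ 2 := by
    intro i hi
    set y : Fin n → ℝ := fun j => t⁻¹ * link A i x j with hy
    have hy0 : ∀ j, 0 ≤ y j := fun j => mul_nonneg (inv_nonneg.mpr ht0.le) (link_nonneg hA hx i j)
    have e1 : deg A x i = t * L 1 A y := by
      rw [hy, L_smul, L_one_link]; field_simp
    have e2 : L 2 A (link A i x) = t ^ 2 * L 2 A y := by
      rw [hy, L_smul]; field_simp
    have e3 : L 3 A (link A i x) = t ^ 3 * L 3 A y := by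
      rw [hy, L_smul]; field_simp
    have k1 := hF.link_eq (r := 3) hA hx h1 hi
    have k2 := hF.link_le (r := 3) hA hx h1 hi
    have k3 : deg A x i ≤ 1 := h1 ▸ deg_le hA hx i
    push_cast at k1 k2
    rw [e1, e3] at k1 k2
    rw [e1] at k3
    have hlt := lt_line (N := (s : ℝ) - 1) (C := L 1 A y) (m := L 2 A y) (e := L 3 A y)
      (by linarith) (L_nonneg hA hy0 3) (by linarith [goodman hA hy0]) ?_ ?_ ?_ ?_
    · rw [e1, e2]
      have := mul_lt_mul_of_pos_left hlt (pow_pos ht0 2)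
      linarith
    · refine lt_of_mul_lt_mul_left ?_ (pow_pos ht0 3).le
      rw [k1, h2]
      unfold partsFour at h4
      linarith
    · refine le_of_mul_le_mul_left ?_ (pow_pos ht0 3)
      linarith
    · refine le_of_mul_le_mul_left ?_ ht0
      linarith
    · intro τ ζ hζ hζτ hC hm
      have := triangleBound (s := s - 1) (by omega) n A y hA hy0 τ ζ hζ hζτ
      rw [Nat.cast_sub (by omega : 1 ≤ s), Nat.cast_one] at this
      exact this hC hm
  have hlt : 3 * L 3 A x <
      (s - 2) * t * (2 * L 2 A x) - (s - 1) * (s - 2) / 2 * t ^ 2 * L 1 A x := by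
    rw [← sum_mul_L_two_link hA, ← sum_mul_deg hA, L_one, mul_sum, mul_sum, ← sum_sub_distrib]
    have hpos : ∃ i ∈ univ, 0 < x i := by
      by_contra h
      push Not at h
      have := sum_nonpos h
      rw [← L_one A, h1] at this
      linarith
    obtain ⟨i, hi, hxi⟩ := hpos
    refine sum_lt_sum (fun j _ => ?_) ⟨i, hi, ?_⟩
    · rcases (hx j).eq_or_lt with h | h
      · rw [← h]; simp
      · have := mul_le_mul_of_nonneg_left (key j h).le h.le
        linarith
    · have := mul_lt_mul_of_pos_left (key i hxi) hxi
      linarith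
  rw [h1, h2] at hlt
  unfold partsThree at h3
  linarith

theorem partsFour_le {s : ℕ} (hs : 4 ≤ s) (hA : A ∈ matrices n)
    (hx : ∀ i, 0 ≤ x i) (h1 : L 1 A x = 1)
    (h2 : L 2 A x ∈ Set.Icc (((s : ℝ) - 2) / (2 * (s - 1))) ((s - 1) / (2 * s))) :
    partsFour s (weightX s (L 2 A x)) ≤ L 4 A x := by
  have hS : (4 : ℝ) ≤ s := by exact_mod_cast hs
  have hS1 : (s : ℝ) - 1 ≠ 0 := by linarith
  by_contra h
  push Not at h
  have hcont : Continuous fun c => partsFour s (weightX s c) := by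
    have := continuous_weightX s
    unfold partsFour
    fun_prop
  have hend : ∀ B ∈ matrices n, ∀ y : Fin n → ℝ, (∀ i, 0 ≤ y i) → L 1 B y = 1 →
      L 2 B y = ((s : ℝ) - 2) / (2 * (s - 1)) ∨ L 2 B y = ((s : ℝ) - 1) / (2 * s) →
      partsFour s (weightX s (L 2 B y)) ≤ L 4 B y := by
    rintro B hB y hy hy1 (hy2 | hy2)
    · have h3 := le_L_four_of_turan hB hy hy1 (R := (s : ℝ) - 1) (by linarith)
        (by rw [hy2]; ring)
      refine le_trans (le_of_eq ?_) h3
      rw [hy2, weightX_lower (by omega), partsFour]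
      field_simp; ring
    · have h3 := le_L_four_of_turan hB hy hy1 (R := s) (by linarith) hy2
      refine le_trans (le_of_eq ?_) h3
      rw [hy2, weightX_upper (by omega), partsFour]
      field_simp; ring
  obtain ⟨B, hB, y, hy, hy1, hy2, hy3, hF⟩ := exists_firstOrder (r := 4)
    (Φ := fun c => partsFour s (weightX s c))
    (μ := fun c => (s - 2) * (s - 3) / 2 * weightX s c ^ 2)
    hcont.continuousOn (fun c hc => hasDerivAt_partsFour (by omega) hc.2) hend hA hx h1 h2 h
  exact not_firstOrder_four hs (hasDerivAt_weightX (by omega) hy2.2).2 hB hy hy1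
    (weightX_spec (by omega) hy2.2.le)
    (partsThree_le (by omega) (triangleBound (by omega)) hB hy hy1 (Set.Ioo_subset_Icc_self hy2))
    hy3 hF

/-! ### The extremal pair -/

theorem completeMatrix_mem (s : ℕ) : completeMatrix s ∈ matrices s := by
  refine ⟨fun i => by simp [completeMatrix], fun i j => ⟨?_, ?_, ?_⟩⟩
  · simp only [completeMatrix, Matrix.of_apply]; split_ifs <;> norm_num
  · simp only [completeMatrix, Matrix.of_apply, eq_comm]
  · simp only [completeMatrix, Matrix.of_apply]; split_ifs <;> norm_num

theorem sum_link_completeMatrix_pow {s k : ℕ} (hk : k ≠ 0) (i : Fin s) (y : Fin s → ℝ) :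
    ∑ j, link (completeMatrix s) i y j ^ k = ∑ j, y j ^ k - y i ^ k := by
  rw [← sum_erase_eq_sub (mem_univ i), ← add_sum_erase _ _ (mem_univ i)]
  simp only [link, completeMatrix, Matrix.of_apply, if_true, zero_mul, zero_pow hk, zero_add]
  refine sum_congr rfl fun j hj => ?_
  rw [if_neg (ne_of_mem_erase hj).symm, one_mul]

theorem two_mul_L_two_completeMatrix {s : ℕ} (y : Fin s → ℝ) :
    2 * L 2 (completeMatrix s) y = (∑ i, y i ^ 1) ^ 2 - ∑ i, y i ^ 2 := by
  rw [← sum_mul_deg (completeMatrix_mem s), sq (∑ i, y i ^ 1), sum_mul, ← sum_sub_distrib]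
  refine sum_congr rfl fun i _ => ?_
  have := sum_link_completeMatrix_pow one_ne_zero i y
  rw [← L_one_link, L_one]
  simp only [pow_one] at this ⊢
  rw [this]; ring

theorem six_mul_L_three_completeMatrix {s : ℕ} (y : Fin s → ℝ) :
    6 * L 3 (completeMatrix s) y =
      (∑ i, y i ^ 1) ^ 3 - 3 * (∑ i, y i ^ 1) * (∑ i, y i ^ 2) + 2 * ∑ i, y i ^ 3 := by
  have h : ∀ i, y i * L 2 (completeMatrix s) (link (completeMatrix s) i y) =
      1 / 2 * (((∑ i, y i ^ 1) ^ 2 - ∑ i, y i ^ 2) * y i ^ 1 - 2 * (∑ i, y i ^ 1) * y i ^ 2 +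
        2 * y i ^ 3) := by
    intro i
    have := two_mul_L_two_completeMatrix (link (completeMatrix s) i y)
    rw [sum_link_completeMatrix_pow one_ne_zero, sum_link_completeMatrix_pow two_ne_zero] at this
    linear_combination (y i / 2) * this
  have h3 := sum_mul_L_two_link (completeMatrix_mem s) y
  simp_rw [h, ← mul_sum, sum_add_distrib, sum_sub_distrib, ← mul_sum] at h3
  linear_combination -2 * h3

theorem mul_L_four_completeMatrix {s : ℕ} (y : Fin s → ℝ) :
    24 * L 4 (completeMatrix s) y =
      (∑ i, y i ^ 1) ^ 4 - 6 * (∑ i, y i ^ 1) ^ 2 * (∑ i, y i ^ 2) +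
        8 * (∑ i, y i ^ 1) * (∑ i, y i ^ 3) + 3 * (∑ i, y i ^ 2) ^ 2 - 6 * ∑ i, y i ^ 4 := by
  have h : ∀ i, y i * L 3 (completeMatrix s) (link (completeMatrix s) i y) =
      1 / 6 * (((∑ i, y i ^ 1) ^ 3 - 3 * (∑ i, y i ^ 1) * (∑ i, y i ^ 2) + 2 * ∑ i, y i ^ 3) *
        y i ^ 1 - (3 * (∑ i, y i ^ 1) ^ 2 - 3 * ∑ i, y i ^ 2) * y i ^ 2 +
        6 * (∑ i, y i ^ 1) * y i ^ 3 - 6 * y i ^ 4) := by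
    intro i
    have := six_mul_L_three_completeMatrix (link (completeMatrix s) i y)
    rw [sum_link_completeMatrix_pow one_ne_zero, sum_link_completeMatrix_pow two_ne_zero,
      sum_link_completeMatrix_pow three_ne_zero] at this
    linear_combination (y i / 6) * this
  have h4 := sum_mul_L_three_link (completeMatrix_mem s) y
  simp_rw [h, ← mul_sum, sum_sub_distrib, sum_add_distrib, sum_sub_distrib, ← mul_sum] at h4
  linear_combination -6 * h4

theorem sum_extremalVector_pow {s : ℕ} (hs : 1 ≤ s) (c : ℝ) (k : ℕ) :
    ∑ i, extremalVector s c i ^ k = (s - 1) * weightX s c ^ k + weightY s c ^ k := by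
  obtain ⟨m, rfl⟩ : ∃ m, s = m + 1 := ⟨s - 1, by omega⟩
  rw [Fin.sum_univ_castSucc]
  simp [extremalVector]

theorem weightY_eq {s : ℕ} (hs : 1 ≤ s) (c : ℝ) : weightY s c = 1 - (s - 1) * weightX s c := by
  have hS : (1 : ℝ) ≤ s := by exact_mod_cast hs
  unfold weightX weightY
  field_simp; ring

theorem extremalVector_nonneg {s : ℕ} (hs : 2 ≤ s) {c : ℝ} (hc : (s - 2) / (2 * (s - 1)) ≤ c)
    (i : Fin s) : 0 ≤ extremalVector s c i := by
  have hS : (2 : ℝ) ≤ s := by exact_mod_cast hs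
  have hS1 : 0 < (s : ℝ) - 1 := by linarith
  have hw := Real.sqrt_nonneg (1 - 2 * (s : ℝ) / (s - 1) * c)
  have hX := mul_weightX hs c
  unfold extremalVector
  split_ifs
  · refine nonneg_of_mul_nonneg_right (b := weightX s c) (a := (s : ℝ)) ?_ (by linarith)
    linarith
  · -- the square root is at most its value `1 / (s - 1)` at the left end of the interval
    have hle : Real.sqrt (1 - 2 * (s : ℝ) / (s - 1) * c) ≤ 1 / (s - 1) := by
      refine Real.sqrt_le_iff.mpr ⟨by positivity, ?_⟩
      have h1 : 2 * (s : ℝ) / (s - 1) * ((s - 2) / (2 * (s - 1))) ≤ 2 * (s : ℝ) / (s - 1) * c :=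
        mul_le_mul_of_nonneg_left hc (by positivity)
      have h2 : 1 - 2 * (s : ℝ) / (s - 1) * ((s - 2) / (2 * (s - 1))) = (1 / (s - 1)) ^ 2 := by
        field_simp; ring
      linarith
    rw [le_div_iff₀ hS1] at hle
    rw [weightY_eq (by omega)]
    nlinarith

theorem L_one_extremal {s : ℕ} (hs : 1 ≤ s) (c : ℝ) :
    L 1 (completeMatrix s) (extremalVector s c) = 1 := by
  have := sum_extremalVector_pow hs c 1
  simp only [pow_one] at this
  rw [L_one, this, weightY_eq hs]; ring

theorem L_two_extremal {s : ℕ} (hs : 2 ≤ s) {c : ℝ} (hc : c ≤ (s - 1) / (2 * s)) :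
    L 2 (completeMatrix s) (extremalVector s c) = c := by
  have h := two_mul_L_two_completeMatrix (extremalVector s c)
  rw [sum_extremalVector_pow (by omega), sum_extremalVector_pow (by omega),
    weightY_eq (by omega)] at h
  linear_combination h / 2 - weightX_spec hs hc

theorem L_three_extremal {s : ℕ} (hs : 1 ≤ s) (c : ℝ) :
    L 3 (completeMatrix s) (extremalVector s c) = partsThree s (weightX s c) := by
  have h := six_mul_L_three_completeMatrix (extremalVector s c)
  simp only [sum_extremalVector_pow hs] at h
  rw [weightY_eq hs] at h
  rw [partsThree]
  linear_combination h / 6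

theorem L_four_extremal {s : ℕ} (hs : 1 ≤ s) (c : ℝ) :
    L 4 (completeMatrix s) (extremalVector s c) = partsFour s (weightX s c) := by
  have h := mul_L_four_completeMatrix (extremalVector s c)
  simp only [sum_extremalVector_pow hs] at h
  rw [weightY_eq hs] at h
  rw [partsFour]
  linear_combination h / 24

theorem mem_Icc_of_xi {c : ℝ} (hc : c < 1 / 2) (hs : 2 ≤ xi c) :
    c ∈ Set.Icc (((xi c : ℝ) - 2) / (2 * (xi c - 1))) ((xi c - 1) / (2 * xi c)) := by
  have hS : (2 : ℝ) ≤ xi c := by exact_mod_cast hs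
  have hc' : 0 < 1 - 2 * c := by linarith
  have h1 : 1 / (1 - 2 * c) ≤ xi c := Nat.le_ceil _
  have h2 : ((xi c - 1 : ℕ) : ℝ) < 1 / (1 - 2 * c) := Nat.lt_ceil.mp (by
    change xi c - 1 < xi c
    omega)
  rw [Nat.cast_sub (by omega), Nat.cast_one, lt_div_iff₀ hc'] at h2
  rw [div_le_iff₀ hc'] at h1
  constructor
  · rw [div_le_iff₀ (by linarith)]; linarith
  · rw [le_div_iff₀ (by linarith)]; linarith

end CliqueForms

theorem theorem1 (c : ℝ) (hc0 : 0 < c) (hc1 : c < 1 / 2) (r n : ℕ) (hr : r = 3 ∨ r = 4)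
    (hrs : r ≤ CliqueForms.xi c) (hsn : CliqueForms.xi c ≤ n) :
    (CliqueForms.completeMatrix (CliqueForms.xi c),
        CliqueForms.extremalVector (CliqueForms.xi c) c) ∈
      CliqueForms.feasible (CliqueForms.xi c) c ∧
    IsLeast (CliqueForms.values r n c) (CliqueForms.phi r c) := by
  open CliqueForms in
  have hs : 3 ≤ xi c := by omega
  have hmem := mem_Icc_of_xi hc1 (by omega)
  have hfeas : (completeMatrix (xi c), extremalVector (xi c) c) ∈ feasible (xi c) c :=
    ⟨completeMatrix_mem _, extremalVector_nonneg (by omega) hmem.1, L_one_extremal (by omega) c,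
      L_two_extremal (by omega) hmem.2⟩
  refine ⟨hfeas, ⟨xi c, hrs, hsn, _, hfeas, rfl⟩, ?_⟩
  rintro _ ⟨k, -, -, ⟨A, x⟩, ⟨hA, hx, h1, h2⟩, rfl⟩
  simp only at hA hx h1 h2 ⊢
  rcases hr with rfl | rfl
  · rw [phi, L_three_extremal (by omega)]
    have := partsThree_le hs (triangleBound (by omega)) hA hx h1 (h2.symm ▸ hmem)
    rwa [h2] at this
  · rw [phi, L_four_extremal (by omega)]
    have := partsFour_le hrs hA hx h1 (h2.symm ▸ hmem)
    rwa [h2] at this
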